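/- Let \(d\in\{3,4,\dots\}\cup\{\infty\}\), where \(\mathbb{R}^\infty:=\ell^2\) is the space of real square summable sequences. A kernel \(K\colon X\times X\to\mathbb{C}\) is called positive definite if \(\sum_{i,j=1}^m c_i\overline{c_j}K(x_i,x_j)\ge 0\) for all \(m\), \(x_1,\dots,x_m\in X\), \(c\in\mathbb{C}^m\), and strictly positive definite on \(S\subseteq X\) if this sum is \(>0\) whenever \(x_1,\dots,x_m\in S\) are distinct and \(c\ne0\). Let \(K\colon\mathbb{R}^d\times\mathbb{R}^d\to\mathbb{C}\) be a continuous positive definite kernel that is isotropic, i.e. \(K(Ux,Uy)=K(x,y)\) for every \(U\) in the group of linear isometries of \(\mathbb{R}^d\), with the representation \[ K(x,y)=\sum_{n=0}^\infty \alpha_n(\|x\|,\|y\|)\,\bar P_n\Bigl(\Bigl\langle \tfrac{x}{\|x\|},\tfrac{y}{\|y\|}\Bigr\rangle\Bigr), \] where the \(\alpha_n\colon[0,\infty)^2\to\mathbb{C}\) are continuous positive definite kernels with \(\sum_{n}\alpha_n(r,r)<\infty\) for all \(r\ge0\) and \(\alpha_n(r,0)=\alpha_n(0,r)=0\) for all \(r\ge0\),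 \(n\ge1\). Here \(\bar P_n(t)=P_n(t)/P_n(1)\) for \(d<\infty\), with \(P_n\) the Gegenbauer polynomial of index \((d-2)/2\) and degree \(n\), and \(\bar P_n(t)=t^n\) for \(d=\infty\). (Since \(\bar P_0\equiv1\), the value of the argument of \(\bar P_n\) at \(x=0\) or \(y=0\) is immaterial.) Then the following are equivalent: (i) \(K\) is strictly positive definite on \(\mathbb{R}^d\). (ii) \(\alpha_0(0,0)>0\), and for all \(m\in\mathbb{N}\), distinct \(r_1,\dots,r_m\in(0,\infty)\) and \(c\in\mathbb{C}^m\setminus\{0\}\), the set \(\{n\in\mathbb{N}_0:\sum_{i,j=1}^m c_i\overline{c_j}\,\alpha_n(r_i,r_j)>0\}\) contains infinitely many even and infinitely many odd integers. (iii) \(\alpha_0(0,0)>0\), and for each \(\gamma\ge0\) the kernels \(\sum_{2n\ge\gamma}\alpha_{2n}\) and \(\sum_{2n+1\ge\gamma}\alpha_{2n+1}\) are both strictly positive definite on \((0,\infty)\). Furthermore, the following condition is sufficient for (i): (iv) \(\alpha_0(0,0)>0\), and \(\alpha_n\) is strictly positive definite on \((0,\infty)\) for infinitely many even and infinitely many odd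 \(n\in\mathbb{N}_0\). If the condition \(\alpha_0(0,0)>0\) is dropped from (ii), (iii) and (iv), then (ii) and (iii) are each equivalent to strict positive definiteness of \(K\) on \(\mathbb{R}^d\setminus\{0\}\), and (iv) is sufficient for it. -/

import Mathlib

open scoped NNReal ComplexConjugate ComplexOrder

/-- The space `ℝ^d` for `d ∈ ℕ ∪ {∞}`: Euclidean space for finite `d`, and the space `ℓ²` of
square summable real sequences for `d = ∞`. -/
def RSpace (d : ℕ∞) : Type :=
  match d with
  | none => lp (fun _ : ℕ => ℝ) 2
  | some n => EuclideanSpace ℝ (Fin n)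

noncomputable instance instNormedAddCommGroupRSpace (d : ℕ∞) : NormedAddCommGroup (RSpace d) :=
  match d with
  | none => inferInstanceAs (NormedAddCommGroup (lp (fun _ : ℕ => ℝ) 2))
  | some n => inferInstanceAs (NormedAddCommGroup (EuclideanSpace ℝ (Fin n)))

noncomputable instance instInnerProductSpaceRSpace (d : ℕ∞) : InnerProductSpace ℝ (RSpace d) :=
  match d with
  | none => inferInstanceAs (InnerProductSpace ℝ (lp (fun _ : ℕ => ℝ) 2))
  | some n => inferInstanceAs (InnerProductSpace ℝ (EuclideanSpace ℝ (Fin n)))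

/-- The quadratic form `∑ i j, c_i * conj c_j * K (x_i, x_j)`. -/
noncomputable def kernelForm {X : Type*} (K : X → X → ℂ) {m : ℕ} (x : Fin m → X)
    (c : Fin m → ℂ) : ℂ :=
  ∑ i, ∑ j, c i * conj (c j) * K (x i) (x j)

/-- Positive definite kernels. In the order of `ℂ`, `0 ≤ z` says that `z` is real and
nonnegative. -/
def IsPosDefKernel {X : Type*} (K : X → X → ℂ) : Prop :=
  ∀ (m : ℕ) (x : Fin m → X) (c : Fin m → ℂ), 0 ≤ kernelForm K x c

/-- Strict positive definiteness on a subset `S`: the form is (real and) strictly positive for all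
distinct points of `S` and every nonzero coefficient vector. -/
def IsStrictPosDefKernelOn {X : Type*} (S : Set X) (K : X → X → ℂ) : Prop :=
  ∀ (m : ℕ) (x : Fin m → X) (c : Fin m → ℂ), Function.Injective x → (∀ i, x i ∈ S) → c ≠ 0 →
    0 < kernelForm K x c

/-- Invariance under the group of (surjective) linear isometries. -/
def IsIsotropic {E : Type*} [NormedAddCommGroup E] [InnerProductSpace ℝ E]
    (K : E → E → ℂ) : Prop :=
  ∀ (U : E ≃ₗᵢ[ℝ] E) (x y : E), K (U x) (U y) = K x y

/-- The Gegenbauer polynomial of index `l` and degree `n`, by its three-term recurrence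
`n * C_n(t) = 2 * t * (n + l - 1) * C_{n-1}(t) - (n + 2 * l - 2) * C_{n-2}(t)`. -/
noncomputable def gegenbauer (l : ℝ) : ℕ → ℝ → ℝ
  | 0, _ => 1
  | 1, t => 2 * l * t
  | n + 2, t =>
    (2 * t * (n + 1 + l) * gegenbauer l (n + 1) t - (n + 2 * l) * gegenbauer l n t) / (n + 2)

/-- The normalized Gegenbauer polynomial of index `(d - 2) / 2` and degree `n`, for `d ≥ 3`, where
the value at `1` by which one divides is positive; it is `t ^ n` for `d = ∞`. -/
noncomputable def normGegenbauer (d : ℕ∞) (n : ℕ) (t : ℝ) : ℝ :=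
  match d with
  | none => t ^ n
  | some d => gegenbauer (((d : ℝ) - 2) / 2) n t / gegenbauer (((d : ℝ) - 2) / 2) n 1

/-- `α` is the family of coefficient kernels on `[0, ∞)` of the kernel `K` on `ℝ^d`. At `x = 0` or
`y = 0` the argument of the polynomials is immaterial: the polynomial of degree `0` is constant and
the kernels with `n ≥ 1` vanish. -/
structure IsIsotropicExpansion (d : ℕ∞) (K : RSpace d → RSpace d → ℂ)
    (α : ℕ → ℝ≥0 → ℝ≥0 → ℂ) : Prop where
  continuous : ∀ n, Continuous (Function.uncurry (α n))
  posDef : ∀ n, IsPosDefKernel (α n)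
  summable_diag : ∀ r, Summable fun n => α n r r
  zero_right : ∀ n, 1 ≤ n → ∀ r, α n r 0 = 0
  zero_left : ∀ n, 1 ≤ n → ∀ r, α n 0 r = 0
  hasSum : ∀ x y : RSpace d,
    HasSum (fun n => α n ‖x‖₊ ‖y‖₊ *
      (normGegenbauer d n (inner ℝ ((‖x‖⁻¹ : ℝ) • x) ((‖y‖⁻¹ : ℝ) • y)) : ℂ)) (K x y)

/-- For all distinct positive radii and every nonzero coefficient vector, the form of `α n` is
strictly positive for infinitely many even and for infinitely many odd `n`. -/
def FormsPosInfEvenOdd (α : ℕ → ℝ≥0 → ℝ≥0 → ℂ) : Prop :=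
  ∀ (m : ℕ) (r : Fin m → ℝ≥0) (c : Fin m → ℂ), Function.Injective r → (∀ i, 0 < r i) → c ≠ 0 →
    {n : ℕ | Even n ∧ 0 < kernelForm (α n) r c}.Infinite ∧
    {n : ℕ | Odd n ∧ 0 < kernelForm (α n) r c}.Infinite

/-- The sum of the kernels `α (2 * n)` over all `n` with `2 * n ≥ γ`. -/
noncomputable def evenTail (α : ℕ → ℝ≥0 → ℝ≥0 → ℂ) (γ : ℝ) (r s : ℝ≥0) : ℂ :=
  ∑' n : {n : ℕ // γ ≤ 2 * (n : ℝ)}, α (2 * n) r s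

/-- The sum of the kernels `α (2 * n + 1)` over all `n` with `2 * n + 1 ≥ γ`. -/
noncomputable def oddTail (α : ℕ → ℝ≥0 → ℝ≥0 → ℂ) (γ : ℝ) (r s : ℝ≥0) : ℂ :=
  ∑' n : {n : ℕ // γ ≤ 2 * (n : ℝ) + 1}, α (2 * n + 1) r s

/-- All even and all odd tail sums are strictly positive definite on `(0, ∞)`. -/
def TailsStrictPosDef (α : ℕ → ℝ≥0 → ℝ≥0 → ℂ) : Prop :=
  ∀ γ : ℝ, 0 ≤ γ → IsStrictPosDefKernelOn (Set.Ioi 0) (evenTail α γ) ∧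
    IsStrictPosDefKernelOn (Set.Ioi 0) (oddTail α γ)

/-- Infinitely many kernels with even and infinitely many with odd index are strictly positive
definite on `(0, ∞)`. -/
def InfEvenOddStrictPosDef (α : ℕ → ℝ≥0 → ℝ≥0 → ℂ) : Prop :=
  {n : ℕ | Even n ∧ IsStrictPosDefKernelOn (Set.Ioi 0) (α n)}.Infinite ∧
  {n : ℕ | Odd n ∧ IsStrictPosDefKernelOn (Set.Ioi 0) (α n)}.Infinite

/-! Expand the form of `K` at finitely many points as a sum over `n`. By Schoenberg's theorem and
the Schur product theorem every term is nonnegative, so the form is positive exactly when some term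
is.

Sufficiency: fix a nonzero point carrying a nonzero coefficient. Replacing each direction by a
representative of its line costs only a sign to the power `n`. Between distinct lines the normalized
polynomials tend to `0` as `n` grows, so for large `n` the `n`-th term is at least half the form of
`α n` restricted to the points of one line (`eventually_half_hermForm_le`). On that line each
positive radius occurs at most twice, at antipodal points; their coefficients are added for even `n`
and subtracted, up to a common sign, for odd `n`. These two combinations cannot both vanish, so one
parity yields a nonzero vector of radial coefficients, to which the hypothesis applies.

Necessity: if the forms of `α n` vanish for all large `n` of one parity, place on each sphere points
of a half circle and their antipodes. Weights on the half circle kill all low degrees, the signs on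
antipodes kill the other parity, and the assumption kills the rest, so the form of `K` is zero
(`exists_form_pos`).

The tail condition is equivalent because a sum of nonnegative forms is positive iff one summand is.
The origin matters only when the coefficients are supported there. -/

open Filter Topology

/-! ### Fischer inner product and zonal harmonics -/

section Fischer

open MvPolynomial

variable {σ : Type*} [Fintype σ]

/-- The Fischer inner product on real polynomials, for which the monomials are orthogonal and
`X ^ s` has square norm `s!`. -/
noncomputable def fischer : MvPolynomial σ ℝ →ₗ[ℝ] MvPolynomial σ ℝ →ₗ[ℝ] ℝ :=
  (basisMonomials σ ℝ).constr ℝ fun s => (∏ i, ((s i).factorial : ℝ)) • lcoeff ℝ s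

theorem fischer_monomial (s : σ →₀ ℕ) (a : ℝ) (q : MvPolynomial σ ℝ) :
    fischer (monomial s a) q = a * ((∏ i, ((s i).factorial : ℝ)) * coeff s q) := by
  have h : monomial s a = a • basisMonomials σ ℝ s := by simp [smul_monomial]
  rw [h, fischer, map_smul, Module.Basis.constr_basis]
  simp [lcoeff]

theorem fischer_self_nonneg (p : MvPolynomial σ ℝ) : 0 ≤ fischer p p := by
  have h : fischer p p = ∑ s ∈ p.support,
      coeff s p * ((∏ i, ((s i).factorial : ℝ)) * coeff s p) := by
    conv_lhs => enter [1]; rw [← support_sum_monomial_coeff p]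
    simp only [map_sum, LinearMap.sum_apply, fischer_monomial]
  rw [h]
  refine Finset.sum_nonneg fun s _ => ?_
  have : 0 ≤ (∏ i, ((s i).factorial : ℝ)) := by positivity
  nlinarith [mul_nonneg this (mul_self_nonneg (coeff s p))]

theorem fischer_one_left (q : MvPolynomial σ ℝ) : fischer 1 q = coeff 0 q := by
  have := fischer_monomial (0 : σ →₀ ℕ) 1 q
  simpa using this

/-- On monomials this is `(k + 1)! = (k + 1) * k!`. It makes directional derivatives and the
Laplacian the adjoints of multiplication by `linForm y` and `sqForm σ`. -/
theorem fischer_X_mul (i : σ) (p q : MvPolynomial σ ℝ) :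
    fischer (X i * p) q = fischer p (pderiv i q) := by
  classical
  induction p using MvPolynomial.induction_on' with
  | add p₁ p₂ h₁ h₂ => simp [mul_add, h₁, h₂]
  | monomial s a =>
    rw [X, monomial_mul, one_mul, fischer_monomial, fischer_monomial, coeff_pderiv,
      add_comm (Finsupp.single i 1) s]
    have : (∏ j, ((((s + Finsupp.single i 1 : σ →₀ ℕ) j).factorial : ℕ) : ℝ)) =
        (∏ j, ((s j).factorial : ℝ)) * (s i + 1) := by
      rw [← Finset.mul_prod_erase _ _ (Finset.mem_univ i),
        ← Finset.mul_prod_erase _ (fun j => ((s j).factorial : ℝ)) (Finset.mem_univ i)]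
      have h : ∀ j ∈ Finset.univ.erase i,
          ((((s + Finsupp.single i 1 : σ →₀ ℕ) j).factorial : ℕ) : ℝ) = (s j).factorial := by
        intro j hj
        have : i ≠ j := (Finset.ne_of_mem_erase hj).symm
        simp [this]
      rw [Finset.prod_congr rfl h]
      simp [Nat.factorial_succ]
      ring
    rw [this]
    ring

/-- The linear form `⟨y, X⟩`. -/
noncomputable def linForm (y : σ → ℝ) : MvPolynomial σ ℝ := ∑ i, C (y i) * X i

/-- The quadratic form `|X|²`. -/
noncomputable def sqForm (σ : Type*) [Fintype σ] : MvPolynomial σ ℝ := ∑ i, X i * X i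

/-- The derivative in direction `y`. -/
noncomputable def dirDeriv (y : σ → ℝ) : Derivation ℝ (MvPolynomial σ ℝ) (MvPolynomial σ ℝ) :=
  ∑ i, y i • pderiv i

/-- The Laplacian. -/
noncomputable def lap : MvPolynomial σ ℝ →ₗ[ℝ] MvPolynomial σ ℝ :=
  ∑ i, (pderiv i).toLinearMap ∘ₗ (pderiv i).toLinearMap

theorem lap_apply (p : MvPolynomial σ ℝ) : lap p = ∑ i, pderiv i (pderiv i p) := by
  simp [lap]

theorem dirDeriv_apply (y : σ → ℝ) (p : MvPolynomial σ ℝ) :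
    dirDeriv y p = ∑ i, C (y i) * pderiv i p := by
  have : ∀ s : Finset σ, (∑ i ∈ s, y i • pderiv (R := ℝ) i) p =
      ∑ i ∈ s, C (y i) * pderiv i p := by
    classical
    intro s
    induction s using Finset.induction_on with
    | empty => simp
    | insert i s hi ih => simp [Finset.sum_insert hi, ih, MvPolynomial.smul_eq_C_mul]
  exact this _

theorem pderiv_linForm (y : σ → ℝ) (i : σ) : pderiv i (linForm y) = C (y i) := by
  classical
  simp [linForm, Pi.single_apply]

theorem pderiv_sqForm (i : σ) : pderiv i (sqForm σ) = 2 * X i := by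
  classical
  simp [sqForm, Pi.single_apply, Finset.sum_add_distrib]
  ring

theorem fischer_linForm_mul (y : σ → ℝ) (p q : MvPolynomial σ ℝ) :
    fischer (linForm y * p) q = fischer p (dirDeriv y q) := by
  simp only [linForm, dirDeriv_apply, Finset.sum_mul, map_sum, LinearMap.sum_apply]
  refine Finset.sum_congr rfl fun i _ => ?_
  rw [mul_assoc, ← MvPolynomial.smul_eq_C_mul, ← MvPolynomial.smul_eq_C_mul, map_smul,
    LinearMap.smul_apply, fischer_X_mul, map_smul]

theorem fischer_sqForm_mul (p q : MvPolynomial σ ℝ) :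
    fischer (sqForm σ * p) q = fischer p (lap q) := by
  simp only [sqForm, lap_apply, Finset.sum_mul, map_sum, LinearMap.sum_apply]
  refine Finset.sum_congr rfl fun i _ => ?_
  rw [mul_assoc, fischer_X_mul, fischer_X_mul]

/-- Reproducing property: moving the factors `linForm y` across one by one differentiates `q` in
direction `y`, and at `y` itself Euler's identity turns each derivative into multiplication by the
degree. -/
theorem fischer_linForm_pow (y : σ → ℝ) (n : ℕ) (q : MvPolynomial σ ℝ) (hq : q.IsHomogeneous n) :
    fischer (linForm y ^ n) q = n.factorial * eval y q := by
  induction n generalizing q with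
  | zero =>
    rw [pow_zero, fischer_one_left]
    have := totalDegree_eq_zero_iff_eq_C.1 (Nat.le_zero.1 hq.totalDegree_le)
    rw [this]
    simp
  | succ n ih =>
    have hD : (dirDeriv y q).IsHomogeneous n := by
      rw [dirDeriv_apply]
      refine IsHomogeneous.sum _ _ _ fun i _ => ?_
      simpa using (isHomogeneous_C σ (y i)).mul (hq.pderiv (i := i))
    rw [pow_succ', fischer_linForm_mul, ih _ hD]
    have h := congrArg (eval y) hq.sum_X_mul_pderiv
    have h2 : eval y (dirDeriv y q) = (n + 1) * eval y q := by
      simpa [dirDeriv_apply] using h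
    rw [h2, Nat.factorial_succ]
    push_cast
    ring

theorem lap_linForm_mul (y : σ → ℝ) (p : MvPolynomial σ ℝ) :
    lap (linForm y * p) = linForm y * lap p + 2 * dirDeriv y p := by
  simp only [lap_apply, dirDeriv_apply, Finset.mul_sum, ← Finset.sum_add_distrib]
  refine Finset.sum_congr rfl fun i _ => ?_
  simp only [pderiv_mul, pderiv_linForm, map_add, pderiv_C]
  ring

theorem lap_sqForm_mul {n : ℕ} (p : MvPolynomial σ ℝ) (hp : p.IsHomogeneous n) :
    lap (sqForm σ * p) = sqForm σ * lap p + C (2 * Fintype.card σ + 4 * n : ℝ) * p := by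
  have h : C (4 * n : ℝ) * p = ∑ i, 4 * (X i * pderiv i p) := by
    rw [← Finset.mul_sum, hp.sum_X_mul_pderiv]
    simp only [map_mul, map_natCast, map_ofNat, nsmul_eq_mul]
    ring
  have h' : C (2 * Fintype.card σ : ℝ) * p = ∑ _i : σ, 2 * p := by
    simp only [map_mul, map_natCast, map_ofNat, Finset.sum_const, Finset.card_univ, nsmul_eq_mul]
    ring
  rw [map_add, add_mul, h, h']
  simp only [lap_apply, Finset.mul_sum, ← Finset.sum_add_distrib]
  refine Finset.sum_congr rfl fun i _ => ?_
  have : pderiv i (2 : MvPolynomial σ ℝ) = 0 := by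
    rw [← map_ofNat (C : ℝ →+* MvPolynomial σ ℝ) 2, pderiv_C]
  simp only [pderiv_mul, pderiv_sqForm, map_add, pderiv_X_self, this]
  ring

theorem dirDeriv_linForm (y : σ → ℝ) (hy : ∑ i, y i * y i = 1) : dirDeriv y (linForm y) = 1 := by
  simp only [dirDeriv_apply, pderiv_linForm, ← C_mul, ← map_sum, hy, C_1]

theorem dirDeriv_sqForm (y : σ → ℝ) : dirDeriv y (sqForm σ) = 2 * linForm y := by
  simp only [dirDeriv_apply, pderiv_sqForm, linForm, Finset.mul_sum]
  exact Finset.sum_congr rfl fun i _ => by ring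

/-- The zonal harmonic of degree `n` with pole `y`: the homogenized Gegenbauer polynomial. -/
noncomputable def zonal (l : ℝ) (y : σ → ℝ) : ℕ → MvPolynomial σ ℝ
  | 0 => 1
  | 1 => C (2 * l) * linForm y
  | n + 2 => C ((n + 2 : ℝ)⁻¹) * (C (2 * (n + 1 + l)) * (linForm y * zonal l y (n + 1)) -
      C (n + 2 * l) * (sqForm σ * zonal l y n))

theorem zonal_add_two (l : ℝ) (y : σ → ℝ) (n : ℕ) :
    C (n + 2 : ℝ) * zonal l y (n + 2) = C (2 * (n + 1 + l)) * (linForm y * zonal l y (n + 1)) -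
      C (n + 2 * l) * (sqForm σ * zonal l y n) := by
  rw [zonal, ← mul_assoc, ← C_mul, mul_inv_cancel₀ (by positivity), C_1, one_mul]

theorem isHomogeneous_linForm (y : σ → ℝ) : (linForm y).IsHomogeneous 1 :=
  IsHomogeneous.sum _ _ _ fun i _ => by
    simpa using (isHomogeneous_C σ (y i)).mul (isHomogeneous_X ℝ i)

theorem isHomogeneous_sqForm : (sqForm σ).IsHomogeneous 2 :=
  IsHomogeneous.sum _ _ _ fun i _ => by
    simpa using (isHomogeneous_X ℝ i).mul (isHomogeneous_X ℝ i)

theorem isHomogeneous_zonal (l : ℝ) (y : σ → ℝ) (n : ℕ) : (zonal l y n).IsHomogeneous n := by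
  induction n using Nat.twoStepInduction with
  | zero => exact isHomogeneous_one σ ℝ
  | one => simpa [zonal] using (isHomogeneous_C σ (2 * l)).mul (isHomogeneous_linForm y)
  | more n h0 h1 =>
    have e1 := (isHomogeneous_C σ (2 * (n + 1 + l))).mul ((isHomogeneous_linForm y).mul h1)
    have e2 := (isHomogeneous_C σ (n + 2 * l)).mul (isHomogeneous_sqForm.mul h0)
    rw [show 0 + (1 + (n + 1)) = n + 2 by ring] at e1
    rw [show 0 + (2 + n) = n + 2 by ring] at e2
    simpa [zonal] using (isHomogeneous_C σ ((n + 2 : ℝ)⁻¹)).mul (e1.sub e2)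

theorem eval_zonal (l : ℝ) (x y : σ → ℝ) (hx : ∑ i, x i * x i = 1) (n : ℕ) :
    eval x (zonal l y n) = gegenbauer l n (∑ i, y i * x i) := by
  induction n using Nat.twoStepInduction with
  | zero => simp [zonal, gegenbauer]
  | one => simp [zonal, gegenbauer, linForm]
  | more n h0 h1 =>
    simp only [zonal, gegenbauer, map_mul, eval_C, map_sub, h0, h1]
    simp only [linForm, sqForm, map_sum, map_mul, eval_X, eval_C, hx]
    field_simp

theorem dirDeriv_C_mul (y : σ → ℝ) (a : ℝ) (p : MvPolynomial σ ℝ) :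
    dirDeriv y (C a * p) = C a * dirDeriv y p := by
  rw [C_mul', Derivation.map_smul, C_mul']

theorem lap_C_mul (a : ℝ) (p : MvPolynomial σ ℝ) : lap (C a * p) = C a * lap p := by
  rw [C_mul', map_smul, C_mul']

/-- Needed for harmonicity: the Laplacian of `linForm y * zonal l y (n + 1)` produces this
derivative. -/
theorem dirDeriv_zonal (l : ℝ) (y : σ → ℝ) (hy : ∑ i, y i * y i = 1) (n : ℕ) :
    dirDeriv y (zonal l y (n + 1)) = C (n + 2 * l) * zonal l y n := by
  induction n using Nat.twoStepInduction with
  | zero => simp [zonal, dirDeriv_linForm y hy, -map_mul]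
  | one =>
    have h := congrArg (dirDeriv y) (zonal_add_two l y 0)
    have hne : (C ((0 : ℕ) + 2 : ℝ) : MvPolynomial σ ℝ) ≠ 0 := by simp
    refine mul_left_cancel₀ hne ?_
    rw [dirDeriv_C_mul] at h
    rw [h]
    have h1 : dirDeriv y (zonal l y (0 + 1)) = C (2 * l) := by
      simp [zonal, dirDeriv_linForm y hy, -map_mul]
    have h0 : dirDeriv y (zonal l y 0) = 0 := by simp [zonal]
    simp only [map_sub, dirDeriv_C_mul]
    simp only [Derivation.leibniz, dirDeriv_linForm y hy, dirDeriv_sqForm, smul_eq_mul, h0, h1]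
    simp only [zonal]
    simp only [map_add, map_mul, map_natCast, map_one, map_ofNat]
    push_cast
    ring
  | more n h0 h1 =>
    have h := congrArg (dirDeriv y) (zonal_add_two l y (n + 1))
    have hne : (C ((n + 1 : ℕ) + 2 : ℝ) : MvPolynomial σ ℝ) ≠ 0 := by
      rw [Ne, C_eq_zero]; positivity
    refine mul_left_cancel₀ hne ?_
    rw [dirDeriv_C_mul] at h
    rw [h]
    simp only [map_sub, dirDeriv_C_mul]
    simp only [Derivation.leibniz, dirDeriv_linForm y hy, dirDeriv_sqForm, smul_eq_mul, h1, h0]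
    have h2 := zonal_add_two l y n
    simp only [map_add, map_mul, map_natCast, map_one, map_ofNat] at h2 ⊢
    push_cast
    linear_combination (-((n : MvPolynomial σ ℝ) + 1 + 2 * C l)) * h2

/-- In the recurrence the derivative term contributes `4 * (n + 1 + l) * (n + 2 * l)` and the term
with `sqForm` contributes `(n + 2 * l) * (2 * card σ + 4 * n)`; they cancel precisely for this `l`.
-/
theorem lap_zonal (l : ℝ) (hl : 2 * l + 2 = Fintype.card σ) (y : σ → ℝ)
    (hy : ∑ i, y i * y i = 1) (n : ℕ) : lap (zonal l y n) = 0 := by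
  induction n using Nat.twoStepInduction with
  | zero => simp [zonal, lap_apply]
  | one => simp [zonal, lap_apply, pderiv_linForm, -map_mul]
  | more n h0 h1 =>
    have h := congrArg lap (zonal_add_two l y n)
    have hne : (C (n + 2 : ℝ) : MvPolynomial σ ℝ) ≠ 0 := by
      rw [Ne, C_eq_zero]; positivity
    refine mul_left_cancel₀ hne ?_
    rw [lap_C_mul] at h
    rw [h, map_sub, lap_C_mul, lap_C_mul, lap_linForm_mul, lap_sqForm_mul _ (isHomogeneous_zonal ..),
      h0, h1, dirDeriv_zonal l y hy, ← hl]
    simp only [map_add, map_mul, map_natCast, map_one, map_ofNat]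
    ring

/-- Multiples of `sqForm σ` are Fischer-orthogonal to harmonic polynomials, so against those a zonal
harmonic acts like a positive multiple of `linForm y ^ n`, hence like evaluation at `y`. -/
theorem zonal_eq_linForm_pow_add (l : ℝ) (hl : 0 < l) (n : ℕ) :
    ∃ a : ℝ, 0 < a ∧ ∀ y : σ → ℝ, ∃ q, zonal l y n = C a * linForm y ^ n + sqForm σ * q := by
  induction n using Nat.twoStepInduction with
  | zero => exact ⟨1, one_pos, fun y => ⟨0, by simp [zonal]⟩⟩
  | one => exact ⟨2 * l, by positivity, fun y => ⟨0, by simp [zonal]⟩⟩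
  | more n _ h1 =>
    obtain ⟨a, ha, h⟩ := h1
    refine ⟨(n + 2 : ℝ)⁻¹ * (2 * (n + 1 + l)) * a, by positivity, fun y => ?_⟩
    obtain ⟨q, hq⟩ := h y
    refine ⟨C ((n + 2 : ℝ)⁻¹) * (C (2 * (n + 1 + l)) * (linForm y * q) -
      C (n + 2 * l) * zonal l y n), ?_⟩
    rw [zonal, hq]
    simp only [C_mul]
    ring

end Fischer

/-! ### Gegenbauer polynomials: positive definiteness, parity, decay -/

theorem gegenbauer_quadratic_nonneg {σ ι : Type*} [Fintype σ] [Fintype ι] (l : ℝ) (hl : 0 < l)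
    (hσ : 2 * l + 2 = Fintype.card σ) (u : ι → σ → ℝ) (hu : ∀ i, ∑ k, u i k * u i k = 1) (n : ℕ)
    (v : ι → ℝ) : 0 ≤ ∑ i, ∑ j, v i * v j * gegenbauer l n (∑ k, u j k * u i k) := by
  obtain ⟨a, ha, h⟩ := zonal_eq_linForm_pow_add (σ := σ) l hl n
  -- Up to the positive factor `a * n!`, the Gegenbauer matrix is the Gram matrix of the zonal
  -- harmonics.
  have key : ∀ i j, fischer (zonal l (u i) n) (zonal l (u j) n) =
      a * (n.factorial * gegenbauer l n (∑ k, u j k * u i k)) := by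
    intro i j
    obtain ⟨q, hq⟩ := h (u i)
    rw [hq, map_add, LinearMap.add_apply, fischer_sqForm_mul, lap_zonal l hσ _ (hu j),
      ← MvPolynomial.smul_eq_C_mul, map_smul, LinearMap.smul_apply,
      fischer_linForm_pow _ _ _ (isHomogeneous_zonal ..), eval_zonal _ _ _ (hu i)]
    simp
  have hnn := fischer_self_nonneg (∑ i, v i • zonal l (u i) n)
  simp only [map_sum, LinearMap.sum_apply, map_smul, LinearMap.smul_apply, smul_eq_mul, key]
    at hnn
  have hc : 0 < a * n.factorial := by positivity
  refine nonneg_of_mul_nonneg_right (hnn.trans_eq ?_) hc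
  rw [Finset.sum_comm]
  simp only [Finset.mul_sum]
  exact Finset.sum_congr rfl fun i _ => Finset.sum_congr rfl fun j _ => by ring

theorem gegenbauer_posSemidef {d : ℕ} (hd : 3 ≤ d) {ι : Type*} [Fintype ι]
    (u : ι → EuclideanSpace ℝ (Fin d)) (hu : ∀ i, ‖u i‖ = 1) (n : ℕ) :
    (Matrix.of fun i j => gegenbauer (((d : ℝ) - 2) / 2) n (inner ℝ (u i) (u j))).PosSemidef := by
  have hd' : (3 : ℝ) ≤ d := by exact_mod_cast hd
  refine .of_dotProduct_mulVec_nonneg ?_ fun v => ?_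
  · ext i j
    simp [real_inner_comm]
  · have h := gegenbauer_quadratic_nonneg (((d : ℝ) - 2) / 2) (by linarith) (by simp; ring)
      (fun i k => u i k) (fun i => by
        have := EuclideanSpace.real_norm_sq_eq (u i)
        rw [hu i] at this
        simpa [sq] using this.symm) n v
    refine h.trans_eq ?_
    simp only [dotProduct, Matrix.mulVec, Finset.mul_sum, Matrix.of_apply, PiLp.inner_apply]
    refine Finset.sum_congr rfl fun i _ => Finset.sum_congr rfl fun j _ => ?_
    simp
    ring

theorem gegenbauer_one_succ {l : ℝ} (n : ℕ) :
    (n + 1) * gegenbauer l (n + 1) 1 = (n + 2 * l) * gegenbauer l n 1 := by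
  induction n with
  | zero => simp [gegenbauer]
  | succ n ih =>
    rw [gegenbauer]
    push_cast
    rw [mul_div_assoc', div_eq_iff (by positivity)]
    linear_combination (n + 2 : ℝ) * ih

theorem gegenbauer_one_pos {l : ℝ} (hl : 0 < l) (n : ℕ) : 0 < gegenbauer l n 1 := by
  induction n with
  | zero => simp [gegenbauer]
  | succ n ih =>
    have h := gegenbauer_one_succ (l := l) n
    have : 0 < (n + 1 : ℝ) * gegenbauer l (n + 1) 1 := by rw [h]; positivity
    exact pos_of_mul_pos_right this (by positivity)

theorem gegenbauer_neg (l : ℝ) (n : ℕ) (t : ℝ) :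
    gegenbauer l n (-t) = (-1) ^ n * gegenbauer l n t := by
  induction n using Nat.twoStepInduction with
  | zero => simp [gegenbauer]
  | one => simp [gegenbauer]
  | more n h0 h1 =>
    rw [gegenbauer, gegenbauer, h0, h1]
    ring

theorem exists_polynomial_gegenbauer (l : ℝ) (n : ℕ) :
    ∃ p : Polynomial ℝ, ∀ t, gegenbauer l n t = p.eval t := by
  induction n using Nat.twoStepInduction with
  | zero => exact ⟨1, fun t => by simp [gegenbauer]⟩
  | one => exact ⟨.C (2 * l) * .X, fun t => by simp [gegenbauer]⟩
  | more n h0 h1 =>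
    obtain ⟨p, hp⟩ := h0
    obtain ⟨q, hq⟩ := h1
    refine ⟨.C ((n + 2 : ℝ)⁻¹) * (.C (2 * (n + 1 + l)) * .X * q - .C (n + 2 * l) * p),
      fun t => ?_⟩
    rw [gegenbauer, hp, hq]
    simp only [Polynomial.eval_mul, Polynomial.eval_sub, Polynomial.eval_C, Polynomial.eval_X]
    field_simp

/-- Comparison with the harmonic series. This divergence forces the energy to zero below; at `l = 0`
(dimension 2) it fails, and `cos (n * θ)` indeed does not decay. -/
theorem not_summable_div_add {l : ℝ} (hl : 0 < l) :
    ¬ Summable fun k : ℕ => 2 * l / (k + 2 + 2 * l) := by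
  intro h
  have h2 : Summable fun k : ℕ => (2 * l / (2 + 2 * l)) * (1 / ((k + 1 : ℕ) : ℝ)) := by
    refine Summable.of_nonneg_of_le (fun k => by positivity) (fun k => ?_) h
    rw [div_mul_div_comm, mul_one]
    push_cast
    gcongr
    nlinarith [(Nat.cast_nonneg k : (0 : ℝ) ≤ k)]
  rw [summable_mul_left_iff (by positivity)] at h2
  exact Real.not_summable_one_div_natCast ((summable_nat_add_iff 1).1 h2)

/-- Solutions of the normalized Gegenbauer recurrence tend to zero inside `(-1, 1)`: the energy
`(p n - t * p (n + 1)) ^ 2 + (1 - t ^ 2) * p (n + 1) ^ 2` decreases to zero. -/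
theorem tendsto_zero_of_gegenbauer_recurrence {l t : ℝ} (hl : 0 < l) (ht : |t| < 1) (p : ℕ → ℝ)
    (hp : ∀ n : ℕ, (n + 1 + 2 * l) * p (n + 2) = 2 * (n + 1 + l) * t * p (n + 1) - (n + 1) * p n) :
    Tendsto p atTop (𝓝 0) := by
  have ht2 : 0 < 1 - t ^ 2 := by nlinarith [(sq_lt_one_iff_abs_lt_one t).2 ht]
  set u : ℕ → ℝ := fun n => p n - t * p (n + 1) with hu
  set E : ℕ → ℝ := fun n => u n ^ 2 + (1 - t ^ 2) * p (n + 1) ^ 2 with hE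
  set w : ℕ → ℝ := fun n => 2 * l / (n + 1 + 2 * l) with hw
  have hw0 : ∀ n, 0 < w n := fun n => by simp only [hw]; positivity
  have hw1 : ∀ n, w n ≤ 1 := fun n => by
    simp only [hw]
    rw [div_le_one (by positivity)]
    linarith [(Nat.cast_nonneg n : (0 : ℝ) ≤ n)]
  have hwle : ∀ n, w (n + 1) ≤ w n := fun n => by
    simp only [hw]
    gcongr
    simp
  -- With `w = 0` the recurrence would conserve `E`; `w n` acts as a damping coefficient.
  have hrec : ∀ n, p (n + 2) = t * p (n + 1) - (1 - w n) * u n := fun n => by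
    have h := hp n
    have hpos : (0 : ℝ) < n + 1 + 2 * l := by positivity
    simp only [hw, hu]
    field_simp
    linear_combination h
  have hEnn : ∀ n, 0 ≤ E n := fun n => by simp only [hE]; positivity
  have hEsucc : ∀ n, E (n + 1) = E n - (1 - (1 - w n) ^ 2) * u n ^ 2 := fun n => by
    have h := hrec n
    simp only [hE]
    have : u (n + 1) = p (n + 1) - t * p (n + 2) := rfl
    rw [this, h]
    ring
  have hdec : ∀ n, E (n + 1) ≤ E n - w n * u n ^ 2 := fun n => by
    rw [hEsucc]
    nlinarith [mul_nonneg (mul_nonneg (hw0 n).le (sub_nonneg.2 (hw1 n))) (sq_nonneg (u n))]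
  have hanti : Antitone E := antitone_nat_of_succ_le fun n => by
    nlinarith [hdec n, mul_nonneg (hw0 n).le (sq_nonneg (u n))]
  -- One `u n` may be small while `E n` is not, but two consecutive values determine `p (n + 1)` and
  -- so control the energy.
  have hlow : ∀ n, (1 - t ^ 2) / 3 * E n ≤ u n ^ 2 + u (n + 1) ^ 2 := fun n => by
    have h1 : (1 - t ^ 2) * p (n + 1) = u (n + 1) - t * (1 - w n) * u n := by
      have : u (n + 1) = p (n + 1) - t * p (n + 2) := rfl
      rw [this, hrec]
      ring
    have h2 : (t * (1 - w n)) ^ 2 ≤ 1 := by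
      rw [mul_pow]
      exact mul_le_one₀ (by linarith) (sq_nonneg _)
        (pow_le_one₀ (by linarith [hw1 n]) (by linarith [hw0 n]))
    have h3 : ((1 - t ^ 2) * p (n + 1)) ^ 2 ≤ 2 * (u n ^ 2 + u (n + 1) ^ 2) := by
      rw [h1]
      nlinarith [sq_nonneg (u (n + 1) + t * (1 - w n) * u n),
        mul_le_mul_of_nonneg_right h2 (sq_nonneg (u n))]
    simp only [hE]
    nlinarith [sq_nonneg (u n), sq_nonneg (u (n + 1)), mul_nonneg (sq_nonneg t) (sq_nonneg (u n))]
  have hsmall : ∀ ε > 0, ∃ n, E n < ε := by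
    intro ε hε
    by_contra! hcon
    refine not_summable_div_add hl ?_
    have hs : 0 < (1 - t ^ 2) / 3 * ε := by positivity
    -- As two consecutive losses are needed per step, the telescoping quantity is `E n + E (n + 1)`.
    -- If `E` stayed above `ε`, the total loss would bound a divergent series.
    have hb : ∀ n : ℕ, ∑ k ∈ Finset.range n, (1 - t ^ 2) / 3 * ε * w (k + 1) + (E n + E (n + 1)) ≤
        E 0 + E 1 := by
      intro n
      induction n with
      | zero => simp
      | succ n ih =>
        rw [Finset.sum_range_succ]
        have a1 := hdec n
        have a2 := hdec (n + 1)
        have a3 := hlow n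
        have a4 : (1 - t ^ 2) / 3 * ε ≤ (1 - t ^ 2) / 3 * E n := by gcongr; exact hcon n
        have a5 : (1 - t ^ 2) / 3 * ε * w (n + 1) ≤ w n * u n ^ 2 + w (n + 1) * u (n + 1) ^ 2 := by
          nlinarith [mul_le_mul_of_nonneg_right (hwle n) (sq_nonneg (u n)),
            mul_le_mul_of_nonneg_left (a4.trans a3) (hw0 (n + 1)).le]
        linarith
    have hsum := summable_of_sum_range_le (f := fun k => (1 - t ^ 2) / 3 * ε * w (k + 1))
      (c := E 0 + E 1) (fun k => (mul_pos hs (hw0 _)).le)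
      (fun n => by linarith [hb n, hEnn n, hEnn (n + 1)])
    rw [summable_mul_left_iff hs.ne'] at hsum
    refine hsum.congr fun k => ?_
    simp only [hw]
    push_cast
    ring_nf
  have hE0 : Tendsto E atTop (𝓝 0) := by
    rw [Metric.tendsto_atTop]
    intro ε hε
    obtain ⟨N, hN⟩ := hsmall ε hε
    exact ⟨N, fun n hn => by
      rw [Real.dist_0_eq_abs, abs_of_nonneg (hEnn n)]
      exact (hanti hn).trans_lt hN⟩
  have hsq : Tendsto (fun n => p (n + 1) ^ 2) atTop (𝓝 0) := by
    refine squeeze_zero (g := fun n => E n / (1 - t ^ 2)) (fun n => sq_nonneg _) (fun n => ?_)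
      (by simpa using hE0.div_const (1 - t ^ 2))
    rw [le_div_iff₀ ht2]
    simp only [hE]
    nlinarith [sq_nonneg (u n)]
  rw [← tendsto_add_atTop_iff_nat 1]
  refine (tendsto_zero_iff_abs_tendsto_zero _).2 ?_
  have := hsq.sqrt
  simpa [Real.sqrt_sq_eq_abs, Function.comp_def] using this

theorem tendsto_gegenbauer_div {l t : ℝ} (hl : 0 < l) (ht : |t| < 1) :
    Tendsto (fun n => gegenbauer l n t / gegenbauer l n 1) atTop (𝓝 0) := by
  refine tendsto_zero_of_gegenbauer_recurrence hl ht _ fun n => ?_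
  have h0 := (gegenbauer_one_pos hl n).ne'
  have h1 := (gegenbauer_one_pos hl (n + 1)).ne'
  have h2 := (gegenbauer_one_pos hl (n + 2)).ne'
  have e1 := gegenbauer_one_succ (l := l) n
  have e2 := gegenbauer_one_succ (l := l) (n + 1)
  push_cast at e2
  have e3 : ((n : ℝ) + 1 + 2 * l) / gegenbauer l (n + 2) 1 = (n + 2) / gegenbauer l (n + 1) 1 := by
    rw [div_eq_div_iff h2 h1]
    linear_combination -e2
  have e4 : ((n : ℝ) + 1) / gegenbauer l n 1 = (n + 2 * l) / gegenbauer l (n + 1) 1 := by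
    rw [div_eq_div_iff h0 h1]
    linear_combination e1
  have e5 : ((n : ℝ) + 2) * gegenbauer l (n + 2) t =
      2 * t * (n + 1 + l) * gegenbauer l (n + 1) t - (n + 2 * l) * gegenbauer l n t := by
    rw [gegenbauer]
    field_simp
  calc ((n : ℝ) + 1 + 2 * l) * (gegenbauer l (n + 2) t / gegenbauer l (n + 2) 1)
      = ((n : ℝ) + 1 + 2 * l) / gegenbauer l (n + 2) 1 * gegenbauer l (n + 2) t := by ring
    _ = ((n : ℝ) + 2) * gegenbauer l (n + 2) t / gegenbauer l (n + 1) 1 := by rw [e3]; ring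
    _ = 2 * (n + 1 + l) * t * (gegenbauer l (n + 1) t / gegenbauer l (n + 1) 1) -
        (n + 2 * l) / gegenbauer l (n + 1) 1 * gegenbauer l n t := by rw [e5]; ring
    _ = _ := by rw [← e4]; ring

/-! ### Normalized polynomials, finite and infinite dimension together -/

theorem half_sub_pos {d : ℕ} (hd : 3 ≤ (d : ℕ∞)) : 0 < ((d : ℝ) - 2) / 2 := by
  have : 3 ≤ d := by exact_mod_cast hd
  have : (3 : ℝ) ≤ d := by exact_mod_cast this
  linarith

theorem normGegenbauer_zero (d : ℕ∞) (t : ℝ) : normGegenbauer d 0 t = 1 := by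
  match d with
  | none => simp [normGegenbauer]
  | some d => simp [normGegenbauer, gegenbauer]

theorem normGegenbauer_one {d : ℕ∞} (hd : 3 ≤ d) (n : ℕ) : normGegenbauer d n 1 = 1 := by
  match d with
  | none => simp [normGegenbauer]
  | some d => exact div_self (gegenbauer_one_pos (half_sub_pos hd) n).ne'

theorem normGegenbauer_neg (d : ℕ∞) (n : ℕ) (t : ℝ) :
    normGegenbauer d n (-t) = (-1) ^ n * normGegenbauer d n t := by
  match d with
  | none => exact neg_pow t n
  | some d => simp [normGegenbauer, gegenbauer_neg, mul_div_assoc]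

theorem tendsto_normGegenbauer {d : ℕ∞} (hd : 3 ≤ d) {t : ℝ} (ht : |t| < 1) :
    Tendsto (fun n => normGegenbauer d n t) atTop (𝓝 0) := by
  match d with
  | none => exact tendsto_pow_atTop_nhds_zero_of_abs_lt_one ht
  | some d => exact tendsto_gegenbauer_div (half_sub_pos hd) ht

theorem exists_polynomial_normGegenbauer (d : ℕ∞) (n : ℕ) :
    ∃ p : Polynomial ℝ, ∀ t, normGegenbauer d n t = p.eval t := by
  match d with
  | none => exact ⟨.X ^ n, fun t => by simp [normGegenbauer]⟩
  | some d =>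
    obtain ⟨p, hp⟩ := exists_polynomial_gegenbauer (((d : ℝ) - 2) / 2) n
    refine ⟨.C (gegenbauer (((d : ℝ) - 2) / 2) n 1)⁻¹ * p, fun t => ?_⟩
    rw [Polynomial.eval_mul, Polynomial.eval_C, ← hp, inv_mul_eq_div]
    rfl

theorem inner_pow_posSemidef {E ι : Type*} [NormedAddCommGroup E] [InnerProductSpace ℝ E]
    [Fintype ι] (u : ι → E) (n : ℕ) :
    (Matrix.of fun i j => (inner ℝ (u i) (u j) : ℝ) ^ n).PosSemidef := by
  induction n with
  | zero =>
    have := Matrix.posSemidef_gram ℝ fun _ : ι => (1 : ℝ)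
    have h : (Matrix.of fun i j => (inner ℝ (u i) (u j) : ℝ) ^ 0) =
        Matrix.gram ℝ fun _ : ι => (1 : ℝ) := by
      ext i j
      simp
    rw [h]
    exact this
  | succ n ih =>
    exact ih.hadamard (Matrix.posSemidef_gram ℝ u)

/-- Schoenberg: the normalized Gegenbauer polynomials are positive definite on the sphere. -/
theorem normGegenbauer_posSemidef {d : ℕ∞} (hd : 3 ≤ d) {ι : Type*} [Fintype ι]
    (u : ι → RSpace d) (hu : ∀ i, ‖u i‖ = 1) (n : ℕ) :
    (Matrix.of fun i j => normGegenbauer d n (inner ℝ (u i) (u j))).PosSemidef := by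
  have hpow := inner_pow_posSemidef u n
  match d with
  | none => exact hpow
  | some d =>
    have h := (gegenbauer_posSemidef (ENat.natCast_le_natCast.1 hd) (u : ι → EuclideanSpace ℝ (Fin d))
      hu n).smul (inv_nonneg.2 (gegenbauer_one_pos (half_sub_pos hd) n).le)
    refine Eq.mp (congrArg Matrix.PosSemidef (Matrix.ext fun i j => ?_)) h
    exact inv_mul_eq_div _ _

theorem comp_equiv_ne_zero {ι ι' : Type*} (e : ι' ≃ ι) {c : ι → ℂ} (hc : c ≠ 0) : c ∘ e ≠ 0 := by
  obtain ⟨i, hi⟩ := Function.ne_iff.1 hc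
  exact Function.ne_iff.2 ⟨e.symm i, by simpa using hi⟩

/-! ### Hermitian forms over finite index types and Schur products -/

section HermForm

variable {ι κ X : Type*} [Fintype ι] [Fintype κ]

/-- The form `∑ i j, c_i * conj c_j * A i j` over an arbitrary finite index type. -/
noncomputable def hermForm (A : ι → ι → ℂ) (c : ι → ℂ) : ℂ :=
  ∑ i, ∑ j, c i * conj (c j) * A i j

theorem kernelForm_comp_equiv (K : X → X → ℂ) {m : ℕ} (e : Fin m ≃ ι) (x : ι → X) (c : ι → ℂ) :
    kernelForm K (x ∘ e) (c ∘ e) = hermForm (fun i j => K (x i) (x j)) c := by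
  unfold kernelForm hermForm
  rw [← e.sum_comp]
  exact Finset.sum_congr rfl fun i _ => e.sum_comp fun j => c (e i) * conj (c j) * K (x (e i)) (x j)

theorem IsPosDefKernel.hermForm_nonneg {K : X → X → ℂ} (hK : IsPosDefKernel K) (x : ι → X)
    (c : ι → ℂ) : 0 ≤ hermForm (fun i j => K (x i) (x j)) c := by
  rw [← kernelForm_comp_equiv K (Fintype.equivFin ι).symm]
  exact hK _ _ _

theorem IsStrictPosDefKernelOn.hermForm_pos {K : X → X → ℂ} {S : Set X}
    (hK : IsStrictPosDefKernelOn S K) {x : ι → X} (hx : Function.Injective x)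
    (hS : ∀ i, x i ∈ S) {c : ι → ℂ} (hc : c ≠ 0) :
    0 < hermForm (fun i j => K (x i) (x j)) c := by
  rw [← kernelForm_comp_equiv K (Fintype.equivFin ι).symm]
  exact hK _ _ _ (hx.comp (Equiv.injective _)) (fun i => hS _) (comp_equiv_ne_zero _ hc)

theorem FormsPosInfEvenOdd.hermForm_infinite {α : ℕ → ℝ≥0 → ℝ≥0 → ℂ} (hα : FormsPosInfEvenOdd α)
    {r : ι → ℝ≥0} (hr : Function.Injective r) (hr0 : ∀ i, 0 < r i) {c : ι → ℂ} (hc : c ≠ 0) :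
    {n : ℕ | Even n ∧ 0 < hermForm (fun i j => α n (r i) (r j)) c}.Infinite ∧
    {n : ℕ | Odd n ∧ 0 < hermForm (fun i j => α n (r i) (r j)) c}.Infinite := by
  have h := hα _ (r ∘ (Fintype.equivFin ι).symm) (c ∘ (Fintype.equivFin ι).symm)
    (hr.comp (Equiv.injective _)) (fun i => hr0 _) (comp_equiv_ne_zero _ hc)
  simpa only [kernelForm_comp_equiv] using h

/-- Merges points with the same image, here points of equal radius, by adding their coefficients. -/
theorem hermForm_comp (A : κ → κ → ℂ) (ρ : ι → κ) (c : ι → ℂ) [DecidableEq κ] :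
    hermForm (fun i j => A (ρ i) (ρ j)) c = hermForm A fun k => ∑ i with ρ i = k, c i := by
  unfold hermForm
  rw [← Finset.sum_fiberwise (g := ρ)]
  refine Finset.sum_congr rfl fun k _ => ?_
  calc _ = ∑ i with ρ i = k, ∑ l, ∑ j with ρ j = l, c i * conj (c j) * A k l := by
        refine Finset.sum_congr rfl fun i hi => ?_
        rw [← Finset.sum_fiberwise (g := ρ)]
        refine Finset.sum_congr rfl fun l _ => Finset.sum_congr rfl fun j hj => ?_
        beta_reduce
        rw [(Finset.mem_filter.1 hi).2, (Finset.mem_filter.1 hj).2]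
    _ = _ := by
        rw [Finset.sum_comm]
        refine Finset.sum_congr rfl fun l _ => ?_
        rw [map_sum, Finset.sum_mul_sum, Finset.sum_mul]
        exact Finset.sum_congr rfl fun i _ => by rw [Finset.sum_mul]

/-- Schur product theorem: `Q` is a sum of rank one matrices, and each of them merely rescales the
coefficients of the form of `A`. -/
theorem hermForm_mul_posSemidef_nonneg {A : ι → ι → ℂ} (hA : ∀ c, 0 ≤ hermForm A c)
    {Q : Matrix ι ι ℝ} (hQ : Q.PosSemidef) (c : ι → ℂ) :
    0 ≤ hermForm (fun i j => A i j * (Q i j : ℂ)) c := by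
  obtain ⟨m, f, hf⟩ := Matrix.posSemidef_iff_eq_sum_vecMulVec.1 hQ
  have hf' : ∀ i j, Q i j = ∑ s, f s i * f s j := fun i j => by
    rw [hf, Matrix.sum_apply]
    simp [Matrix.vecMulVec_apply]
  have h : hermForm (fun i j => A i j * (Q i j : ℂ)) c =
      ∑ s, hermForm A (fun i => c i * f s i) := by
    unfold hermForm
    rw [Finset.sum_comm]
    conv_rhs => rw [Finset.sum_comm]
    rw [Finset.sum_comm]
    refine Finset.sum_congr rfl fun i _ => ?_
    rw [Finset.sum_comm]
    refine Finset.sum_congr rfl fun j _ => ?_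
    beta_reduce
    rw [hf', Complex.ofReal_sum, Finset.mul_sum, Finset.mul_sum]
    refine Finset.sum_congr rfl fun s _ => ?_
    simp
    ring
  rw [h]
  exact Finset.sum_nonneg fun s _ => hA _

/-- Diagonal dominance: by `2 * |v i * v j| ≤ v i ^ 2 + v j ^ 2` the off-diagonal part costs at most
half of `∑ v i ^ 2`, so `Q` dominates half the identity. -/
theorem posSemidef_sub_single_half [DecidableEq ι] {Q : Matrix ι ι ℝ} (hQ : Q.IsHermitian)
    (hdiag : ∀ i, Q i i = 1)
    (hoff : ∀ i j, i ≠ j → |Q i j| ≤ (2 * (Fintype.card ι : ℝ))⁻¹) (k : ι) :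
    (Q - Matrix.single k k (1 / 2 : ℝ)).PosSemidef := by
  refine .of_dotProduct_mulVec_nonneg (hQ.sub ?_) fun v => ?_
  · simp [Matrix.IsHermitian]
  have hcard : 0 < (Fintype.card ι : ℝ) := by exact_mod_cast Fintype.card_pos_iff.2 ⟨k⟩
  set δ : ℝ := (2 * (Fintype.card ι : ℝ))⁻¹ with hδ
  have hδ0 : 0 < δ := by positivity
  have h1 : ∀ i j, (if i = j then v i ^ 2 else 0) - δ * ((v i ^ 2 + v j ^ 2) / 2) ≤
      v i * (Q i j * v j) := by
    intro i j
    by_cases hij : i = j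
    · subst hij
      simp only [if_true, hdiag]
      nlinarith [mul_nonneg hδ0.le (sq_nonneg (v i))]
    · rw [if_neg hij]
      have h2 : |v i * (Q i j * v j)| ≤ δ * ((v i ^ 2 + v j ^ 2) / 2) := by
        rw [show v i * (Q i j * v j) = Q i j * (v i * v j) by ring, abs_mul]
        refine mul_le_mul (hoff i j hij) ?_ (abs_nonneg _) hδ0.le
        rw [abs_le]
        constructor <;> nlinarith [sq_nonneg (v i + v j), sq_nonneg (v i - v j)]
      linarith [neg_abs_le (v i * (Q i j * v j))]
  have h2 : ∑ i, v i ^ 2 / 2 ≤ v ⬝ᵥ (Q.mulVec v) := by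
    simp only [dotProduct, Matrix.mulVec, Finset.mul_sum]
    refine le_trans (le_of_eq ?_) (Finset.sum_le_sum fun i _ => Finset.sum_le_sum fun j _ => h1 i j)
    simp only [Finset.sum_sub_distrib, Finset.sum_ite_eq, Finset.mem_univ, if_true,
      ← Finset.mul_sum, ← Finset.sum_div, Finset.sum_add_distrib, Finset.sum_const,
      Finset.card_univ, nsmul_eq_mul]
    rw [hδ]
    field_simp
    ring
  have h3 : v ⬝ᵥ ((Matrix.single k k (1 / 2 : ℝ)).mulVec v) = v k ^ 2 / 2 := by
    simp [Matrix.single_mulVec, dotProduct, Function.update_apply]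
    ring
  have h4 : v k ^ 2 / 2 ≤ ∑ i, v i ^ 2 / 2 :=
    Finset.single_le_sum (f := fun i => v i ^ 2 / 2) (fun i _ => by positivity) (Finset.mem_univ k)
  rw [Matrix.sub_mulVec, dotProduct_sub]
  simp only [star_trivial]
  linarith

end HermForm

/-- A choice of one of the two unit vectors on each line. -/
theorem exists_line_representative (E : Type*) [NormedAddCommGroup E] [InnerProductSpace ℝ E] :
    ∃ w : E → E, (∀ v, w v = v ∨ w v = -v) ∧ ∀ v, w (-v) = w v := by
  have hne : ∀ v : E, ({v, -v} : Set E).Nonempty := fun v => ⟨v, by simp⟩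
  refine ⟨fun v => (hne v).some, fun v => by simpa using (hne v).some_mem, fun v => ?_⟩
  -- The chosen vector depends only on the set `{v, -v}`.
  have : ({-v, - -v} : Set E) = {v, -v} := by rw [neg_neg, Set.pair_comm]
  simp only [this]

theorem abs_inner_lt_one_of_ne {E : Type*} [NormedAddCommGroup E] [InnerProductSpace ℝ E]
    {a b : E} (ha : ‖a‖ = 1) (hb : ‖b‖ = 1) (h1 : a ≠ b) (h2 : a ≠ -b) : |inner ℝ a b| < 1 := by
  refine lt_of_le_of_ne ((abs_real_inner_le_norm a b).trans (by simp [ha, hb])) fun h => ?_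
  rcases (abs_eq zero_le_one).1 h with h | h
  · exact h1 ((inner_eq_one_iff_of_norm_eq_one ha hb).1 h)
  · refine h2 ((inner_eq_one_iff_of_norm_eq_one (𝕜 := ℝ) ha (by simpa using hb)).1 ?_)
    rw [inner_neg_right, h, neg_neg]

/-! ### Sufficiency: isolating one line through the origin -/

section Sufficiency

variable {d : ℕ∞} {K : RSpace d → RSpace d → ℂ} {α : ℕ → ℝ≥0 → ℝ≥0 → ℂ}

/-- The direction of a vector, with an arbitrary value `e` at the origin. -/
noncomputable def direction {E : Type*} [NormedAddCommGroup E] [InnerProductSpace ℝ E]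
    [DecidableEq E] (e x : E) : E :=
  if x = 0 then e else (‖x‖⁻¹ : ℝ) • x

theorem norm_direction {E : Type*} [NormedAddCommGroup E] [InnerProductSpace ℝ E]
    [DecidableEq E] {e : E} (he : ‖e‖ = 1) (x : E) : ‖direction e x‖ = 1 := by
  unfold direction
  split_ifs with h
  · exact he
  · rw [norm_smul, norm_inv, norm_norm, inv_mul_cancel₀ (norm_ne_zero_iff.2 h)]

theorem IsIsotropicExpansion.hasSum_direction [DecidableEq (RSpace d)]
    (hα : IsIsotropicExpansion d K α) (e x y : RSpace d) :
    HasSum (fun n => α n ‖x‖₊ ‖y‖₊ *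
      (normGegenbauer d n (inner ℝ (direction e x) (direction e y)) : ℂ)) (K x y) := by
  convert hα.hasSum x y using 2 with n
  rcases Nat.eq_zero_or_pos n with rfl | hn
  · simp [normGegenbauer_zero]
  by_cases hx : x = 0
  · simp [hx, hα.zero_left n hn]
  by_cases hy : y = 0
  · simp [hy, hα.zero_right n hn]
  simp [direction, hx, hy]

variable {ι : Type*} [Fintype ι]

theorem hasSum_hermForm {A : ℕ → ι → ι → ℂ} {B : ι → ι → ℂ}
    (h : ∀ i j, HasSum (fun n => A n i j) (B i j)) (c : ι → ℂ) :
    HasSum (fun n => hermForm (A n) c) (hermForm B c) :=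
  hasSum_sum fun i _ => hasSum_sum fun j _ => (h i j).mul_left _

theorem IsIsotropicExpansion.term_nonneg [DecidableEq (RSpace d)] (hd : 3 ≤ d)
    (hα : IsIsotropicExpansion d K α) {e : RSpace d} (he : ‖e‖ = 1) (x : ι → RSpace d)
    (c : ι → ℂ) (n : ℕ) :
    0 ≤ hermForm (fun i j => α n ‖x i‖₊ ‖x j‖₊ *
      (normGegenbauer d n (inner ℝ (direction e (x i)) (direction e (x j))) : ℂ)) c :=
  hermForm_mul_posSemidef_nonneg (A := fun i j => α n ‖x i‖₊ ‖x j‖₊)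
    (fun c => (hα.posDef n).hermForm_nonneg (fun i => ‖x i‖₊) c)
    (normGegenbauer_posSemidef hd _ (fun i => norm_direction he (x i)) n) c

/-- For large `n` the form of the `n`-th term dominates half of the form of `α n` on the points of
a single line. -/
theorem eventually_half_hermForm_le [DecidableEq (RSpace d)] (hd : 3 ≤ d)
    (hα : ∀ n, IsPosDefKernel (α n)) (r : ι → ℝ≥0) (a : ι → RSpace d) (ha : ∀ i, ‖a i‖ = 1)
    (hsep : ∀ i j, a i ≠ a j → |inner ℝ (a i) (a j)| < 1) (i₀ : ι) :
    ∀ᶠ n in atTop, ∀ c : ι → ℂ,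
      (1 / 2 : ℂ) * hermForm (fun i j => α n (r i) (r j)) (fun i => if a i = a i₀ then c i else 0) ≤
      hermForm (fun i j => α n (r i) (r j) * (normGegenbauer d n (inner ℝ (a i) (a j)) : ℂ)) c := by
  classical
  -- Off-diagonal entries are small only between distinct directions. The domination is proved on
  -- the set `W` of these and pulled back along `b`, where the single entry becomes the block of the
  -- indices with direction `a i₀`.
  set W := Finset.univ.image a
  let b : ι → W := fun i => ⟨a i, Finset.mem_image_of_mem _ (Finset.mem_univ i)⟩
  have hW : ∀ w : W, ∃ i, a i = w := fun w => by
    obtain ⟨i, -, hi⟩ := Finset.mem_image.1 w.2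
    exact ⟨i, hi⟩
  have hcard : 0 < (Fintype.card W : ℝ) := by exact_mod_cast Fintype.card_pos_iff.2 ⟨b i₀⟩
  have hev : ∀ᶠ n in atTop, ∀ v w : W, v ≠ w →
      |normGegenbauer d n (inner ℝ (v : RSpace d) (w : RSpace d))| ≤
        (2 * (Fintype.card W : ℝ))⁻¹ := by
    refine eventually_all.2 fun v => eventually_all.2 fun w => ?_
    by_cases hvw : v = w
    · simp [hvw]
    obtain ⟨i, hi⟩ := hW v
    obtain ⟨j, hj⟩ := hW w
    have hne : a i ≠ a j := fun h => hvw (Subtype.ext (by rw [← hi, ← hj, h]))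
    have ht := (tendsto_normGegenbauer hd (hsep i j hne)).abs
    rw [abs_zero] at ht
    filter_upwards [ht.eventually_le_const (show 0 < (2 * (Fintype.card W : ℝ))⁻¹ by positivity)]
      with n hn _
    rwa [← hi, ← hj]
  filter_upwards [hev] with n hn c
  set Q : Matrix W W ℝ := Matrix.of fun v w => normGegenbauer d n (inner ℝ (v : RSpace d) w)
  have hQ : (Q - Matrix.single (b i₀) (b i₀) (1 / 2 : ℝ)).PosSemidef := by
    have hnorm : ∀ w : W, ‖(w : RSpace d)‖ = 1 := fun w => by
      obtain ⟨i, hi⟩ := hW w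
      rw [← hi, ha]
    refine posSemidef_sub_single_half
      (normGegenbauer_posSemidef hd _ hnorm n).isHermitian (fun w => ?_) hn _
    have : inner ℝ (w : RSpace d) w = 1 := by
      rw [real_inner_self_eq_norm_sq, hnorm, one_pow]
    simp only [Matrix.of_apply, this, normGegenbauer_one hd]
  have h := hermForm_mul_posSemidef_nonneg (A := fun i j => α n (r i) (r j))
    (fun c => (hα n).hermForm_nonneg r c) (hQ.submatrix b) c
  rw [← sub_nonneg]
  refine h.trans_eq ?_
  unfold hermForm
  rw [Finset.mul_sum, ← Finset.sum_sub_distrib]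
  refine Finset.sum_congr rfl fun i _ => ?_
  rw [Finset.mul_sum, ← Finset.sum_sub_distrib]
  refine Finset.sum_congr rfl fun j _ => ?_
  have hb : ∀ i, b i₀ = b i ↔ a i = a i₀ := fun i => by
    rw [Subtype.ext_iff, eq_comm]
  by_cases hi : a i = a i₀ <;> by_cases hj : a j = a i₀ <;>
    simp [hb, hi, hj, Q, b]
  ring

theorem IsIsotropicExpansion.hermForm_pos (hd : 3 ≤ d) (hα : IsIsotropicExpansion d K α)
    (hF : FormsPosInfEvenOdd α) {x : ι → RSpace d} (hx : Function.Injective x) {c : ι → ℂ}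
    {i₀ : ι} (hc : c i₀ ≠ 0) (hx₀ : x i₀ ≠ 0) : 0 < hermForm (fun i j => K (x i) (x j)) c := by
  classical
  obtain ⟨e, he⟩ : ∃ e : RSpace d, ‖e‖ = 1 :=
    ⟨(‖x i₀‖⁻¹ : ℝ) • x i₀, by
      rw [norm_smul, norm_inv, norm_norm, inv_mul_cancel₀ (norm_ne_zero_iff.2 hx₀)]⟩
  set u : ι → RSpace d := fun i => direction e (x i) with hu
  have hu1 : ∀ i, ‖u i‖ = 1 := fun i => norm_direction he (x i)
  have hsum := hasSum_hermForm (fun i j => hα.hasSum_direction e (x i) (x j)) c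
  suffices h : ∃ n, 0 < hermForm (fun i j => α n ‖x i‖₊ ‖x j‖₊ *
      (normGegenbauer d n (inner ℝ (u i) (u j)) : ℂ)) c by
    obtain ⟨n, hn⟩ := h
    exact hn.trans_le (le_hasSum hsum n fun m _ => hα.term_nonneg hd he x c m)
  obtain ⟨w, hw, hwneg⟩ := exists_line_representative (RSpace d)
  have hww : ∀ v, w (w v) = w v := fun v => by
    rcases hw v with h | h
    · rw [h, h]
    · rw [h, hwneg, h]
  set a : ι → RSpace d := fun i => w (u i) with ha
  have hσ : ∀ i, ∃ s : ℝ, (s = 1 ∨ s = -1) ∧ u i = s • a i := fun i => by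
    rcases hw (u i) with h | h
    · exact ⟨1, .inl rfl, by simp [ha, h]⟩
    · exact ⟨-1, .inr rfl, by simp [ha, h]⟩
  choose σ hσ hua using hσ
  have ha1 : ∀ i, ‖a i‖ = 1 := fun i => by
    rcases hw (u i) with h | h <;> simp [ha, h, hu1]
  have hsep : ∀ i j, a i ≠ a j → |inner ℝ (a i) (a j)| < 1 := fun i j hij => by
    refine abs_inner_lt_one_of_ne (ha1 i) (ha1 j) hij fun h => hij ?_
    exact (hww (u i)).symm.trans (((congrArg w h).trans (hwneg _)).trans (hww (u j)))
  have hterm : ∀ n i j, normGegenbauer d n (inner ℝ (u i) (u j)) =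
      σ i ^ n * σ j ^ n * normGegenbauer d n (inner ℝ (a i) (a j)) := fun n i j => by
    rw [hua i, hua j, real_inner_smul_left, real_inner_smul_right]
    rcases hσ i with h | h <;> rcases hσ j with h' | h' <;>
      simp [h, h', normGegenbauer_neg, ← mul_pow]
  have hform : ∀ n, hermForm (fun i j => α n ‖x i‖₊ ‖x j‖₊ *
      (normGegenbauer d n (inner ℝ (u i) (u j)) : ℂ)) c =
      hermForm (fun i j => α n ‖x i‖₊ ‖x j‖₊ *
        (normGegenbauer d n (inner ℝ (a i) (a j)) : ℂ)) (fun i => c i * (σ i : ℂ) ^ n) := fun n => by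
    refine Finset.sum_congr rfl fun i _ => Finset.sum_congr rfl fun j _ => ?_
    simp only [hterm, map_mul, map_pow, Complex.conj_ofReal]
    push_cast
    ring
  -- The hypothesis needs positive radii, so the origin gets a dummy one; `C` below gives it
  -- coefficient zero.
  set ρ : ι → ℝ≥0 := fun i => if x i = 0 then ‖x i₀‖₊ else ‖x i‖₊ with hρ
  have hρ0 : ∀ i, 0 < ρ i := fun i => by
    simp only [hρ]
    split_ifs with h
    · simpa using hx₀
    · simpa using h
  set S := Finset.univ.image ρ
  let b : ι → S := fun i => ⟨ρ i, Finset.mem_image_of_mem _ (Finset.mem_univ i)⟩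
  have hS : ∀ s : S, 0 < (s : ℝ≥0) := fun s => by
    obtain ⟨i, -, hi⟩ := Finset.mem_image.1 s.2
    exact hi ▸ hρ0 i
  let C : (ι → ℂ) → S → ℂ := fun τ k =>
    ∑ i with b i = k, if a i = a i₀ ∧ x i ≠ 0 then c i * τ i else 0
  -- Dropping the origin is legitimate because `α n` vanishes there for `n ≥ 1`.
  have hcollapse : ∀ n, 1 ≤ n → ∀ τ : ι → ℂ,
      hermForm (fun i j => α n ‖x i‖₊ ‖x j‖₊) (fun i => if a i = a i₀ then c i * τ i else 0) =
      hermForm (fun s t : S => α n s t) (C τ) := fun n hn τ => by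
    rw [← hermForm_comp (fun s t : S => α n s t) b]
    refine Finset.sum_congr rfl fun i _ => Finset.sum_congr rfl fun j _ => ?_
    by_cases hi : x i = 0
    · simp [hi, hα.zero_left n hn]
    by_cases hj : x j = 0
    · simp [hj, hα.zero_right n hn]
    simp [hi, hj, b, hρ]
  have hev := eventually_half_hermForm_le hd hα.posDef (fun i => ‖x i‖₊) a ha1 hsep i₀
  obtain ⟨N, hN⟩ := eventually_atTop.1 hev
  have hfin : ∀ (τ : ι → ℂ) (P : ℕ → Prop), (∀ n, P n → ∀ i, (σ i : ℂ) ^ n = τ i) →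
      {n | P n ∧ 0 < hermForm (fun s t : S => α n s t) (C τ)}.Infinite →
      ∃ n, 0 < hermForm (fun i j => α n ‖x i‖₊ ‖x j‖₊ *
        (normGegenbauer d n (inner ℝ (u i) (u j)) : ℂ)) c := fun τ P hP hinf => by
    obtain ⟨n, ⟨hPn, hpos⟩, hn⟩ := hinf.exists_gt N
    refine ⟨n, ?_⟩
    rw [hform]
    refine lt_of_lt_of_le ?_ (hN n hn.le _)
    simp only [hP n hPn]
    rw [hcollapse n (by omega)]
    exact mul_pos (by norm_num) hpos
  have hne : C (fun _ => 1) ≠ 0 ∨ C (fun i => σ i) ≠ 0 := by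
    by_contra! hcon
    -- At the radius of `x i₀` this sum is `2 * c i₀`: the only other point that can contribute is
    -- `-x i₀`, whose sign relative to `i₀` is `-1`, so it cancels.
    have h0 : C (fun _ => 1) (b i₀) + σ i₀ * C (fun i => σ i) (b i₀) = 0 := by simp [hcon]
    simp only [C] at h0
    rw [Finset.mul_sum, ← Finset.sum_add_distrib, Finset.sum_eq_single i₀] at h0
    · rw [if_pos ⟨rfl, hx₀⟩, if_pos ⟨rfl, hx₀⟩] at h0
      have : (σ i₀ : ℂ) * σ i₀ = 1 := by rcases hσ i₀ with h | h <;> simp [h]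
      refine hc ?_
      linear_combination (1 / 2 : ℂ) * h0 - (1 / 2 : ℂ) * c i₀ * this
    · intro i hi hii
      by_cases hcond : a i = a i₀ ∧ x i ≠ 0
      · rw [if_pos hcond, if_pos hcond]
        have hnorm : ‖x i‖ = ‖x i₀‖ := by
          have := congrArg Subtype.val (Finset.mem_filter.1 hi).2
          simpa [b, hρ, hcond.2, hx₀] using congrArg NNReal.toReal this
        have hxu : ∀ j, x j ≠ 0 → x j = ‖x j‖ • σ j • a j := fun j hj => by
          rw [← hua j]
          simp [hu, direction, hj]
        have hσne : σ i ≠ σ i₀ := fun h => hii (hx (by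
          rw [hxu i hcond.2, hxu i₀ hx₀, hnorm, h, hcond.1]))
        have : (σ i₀ : ℂ) * σ i = -1 := by
          rcases hσ i with h | h <;> rcases hσ i₀ with h' | h' <;>
            first
            | exact absurd (h.trans h'.symm) hσne
            | simp [h, h']
        linear_combination c i * this
      · simp [hcond]
    · simp
  rcases hne with h | h
  · exact hfin (fun _ => 1) Even (fun n hn i => by
      rcases hσ i with h | h <;> rw [h] <;> simp [hn.neg_one_pow])
      (hF.hermForm_infinite Subtype.val_injective hS h).1
  · exact hfin (fun i => σ i) Odd (fun n hn i => by
      rcases hσ i with h | h <;> rw [h] <;> simp [hn.neg_one_pow])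
      (hF.hermForm_infinite Subtype.val_injective hS h).2

end Sufficiency

/-! ### Necessity: point configurations annihilating unwanted degrees -/

/-- There are points on a half circle and nonzero weights on them that annihilate all monomials of
bounded degree. -/
theorem exists_weights_annihilating_monomials (M : ℕ) :
    ∃ (p : ℕ) (x y b : Fin p → ℝ), b ≠ 0 ∧ Function.Injective x ∧ (∀ k, 0 < x k) ∧
      (∀ k, x k ^ 2 + y k ^ 2 = 1) ∧
      ∀ i ≤ M, ∀ j ≤ M, ∑ k, b k * (x k ^ i * y k ^ j) = 0 := by
  -- One more unknown than the `(M + 1) ^ 2` linear conditions.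
  set p := (M + 1) * (M + 1) + 1
  set x : Fin p → ℝ := fun k => ((k : ℝ) + 2)⁻¹
  set y : Fin p → ℝ := fun k => √(1 - x k ^ 2)
  let A : Matrix (Fin (M + 1) × Fin (M + 1)) (Fin p) ℝ :=
    Matrix.of fun ij k => x k ^ (ij.1 : ℕ) * y k ^ (ij.2 : ℕ)
  have hker : LinearMap.ker A.mulVecLin ≠ ⊥ :=
    LinearMap.ker_ne_bot_of_finrank_lt (by simp [p])
  obtain ⟨b, hb, hb0⟩ := Submodule.exists_mem_ne_zero_of_ne_bot hker
  have hx0 : ∀ k, 0 < x k := fun k => by positivity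
  have hx1 : ∀ k, x k ≤ 1 := fun k => inv_le_one_of_one_le₀ (by
    linarith [(Nat.cast_nonneg (k : ℕ) : (0 : ℝ) ≤ (k : ℕ))])
  refine ⟨p, x, y, b, hb0, fun k l hkl => ?_, hx0, fun k => ?_, fun i hi j hj => ?_⟩
  · have := inv_injective hkl
    exact Fin.ext (by exact_mod_cast add_right_cancel this)
  · rw [Real.sq_sqrt (sub_nonneg.2 (pow_le_one₀ (hx0 k).le (hx1 k)))]
    ring
  · have h := congrFun (LinearMap.mem_ker.1 hb) (⟨i, by omega⟩, ⟨j, by omega⟩)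
    simpa [A, Matrix.mulVec, dotProduct, mul_comm] using h

theorem sum_eval_eq_zero_of_annihilating {κ : Type*} [Fintype κ] {M : ℕ} {x y b : κ → ℝ}
    (h : ∀ i ≤ M, ∀ j ≤ M, ∑ k, b k * (x k ^ i * y k ^ j) = 0) {P : Polynomial ℝ}
    (hP : P.natDegree ≤ M) (s t : ℝ) : ∑ k, b k * P.eval (x k * s + y k * t) = 0 := by
  have hpow : ∀ n ≤ M, ∑ k, b k * (x k * s + y k * t) ^ n = 0 := fun n hn => by
    simp only [add_pow, Finset.mul_sum]
    rw [Finset.sum_comm]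
    refine Finset.sum_eq_zero fun i hi => ?_
    have hi' : i ≤ n := Nat.lt_succ_iff.1 (Finset.mem_range.1 hi)
    have := h i (hi'.trans hn) (n - i) (by omega)
    calc _ = ∑ k, b k * (x k ^ i * y k ^ (n - i)) * (s ^ i * t ^ (n - i) * (n.choose i)) :=
          Finset.sum_congr rfl fun k _ => by rw [mul_pow, mul_pow]; ring
      _ = 0 := by rw [← Finset.sum_mul, this, zero_mul]
  simp only [Polynomial.eval_eq_sum_range, Finset.mul_sum]
  rw [Finset.sum_comm]
  refine Finset.sum_eq_zero fun n hn => ?_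
  have hn' : n ≤ M := (Nat.lt_succ_iff.1 (Finset.mem_range.1 hn)).trans hP
  calc _ = ∑ k, P.coeff n * (b k * (x k * s + y k * t) ^ n) :=
        Finset.sum_congr rfl fun k _ => by ring
    _ = 0 := by rw [← Finset.mul_sum, hpow n hn', mul_zero]

theorem exists_orthonormal_pair {d : ℕ∞} (hd : 3 ≤ d) :
    ∃ e f : RSpace d, ‖e‖ = 1 ∧ ‖f‖ = 1 ∧ inner ℝ e f = 0 := by
  match d with
  | none =>
    have h : Orthonormal ℝ fun i : ℕ => (lp.single 2 i (1 : ℝ) : lp (fun _ : ℕ => ℝ) 2) := by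
      rw [orthonormal_iff_ite]
      intro i j
      rw [lp.inner_single_left]
      simp [lp.single_apply, Pi.single_apply]
    exact ⟨_, _, h.1 0, h.1 1, h.2 zero_ne_one⟩
  | some d =>
    have hd' : 3 ≤ d := ENat.natCast_le_natCast.1 hd
    have h := (EuclideanSpace.basisFun (Fin d) ℝ).orthonormal
    exact ⟨_, _, h.1 ⟨0, by omega⟩, h.1 ⟨1, by omega⟩, h.2 (by simp)⟩

theorem hermForm_prod {ι κ : Type*} [Fintype ι] [Fintype κ] (A : ι → ι → ℂ) (B : κ → κ → ℂ)
    (c : ι → ℂ) (b : κ → ℂ) :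
    hermForm (fun i j : ι × κ => A i.1 j.1 * B i.2 j.2) (fun i => c i.1 * b i.2) =
      hermForm A c * hermForm B b := by
  unfold hermForm
  rw [Finset.sum_mul_sum, Fintype.sum_prod_type]
  refine Finset.sum_congr rfl fun i _ => Finset.sum_congr rfl fun k _ => ?_
  rw [Finset.sum_mul_sum, Fintype.sum_prod_type]
  refine Finset.sum_congr rfl fun j _ => Finset.sum_congr rfl fun l _ => ?_
  rw [map_mul]
  ring

section Necessity

variable {d : ℕ∞} {K : RSpace d → RSpace d → ℂ} {α : ℕ → ℝ≥0 → ℝ≥0 → ℂ}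

/-- Otherwise a form of `K` vanishes. On the points `± r i • ξ k` its `n`-th term is a product of
three forms: that of `α n` in the radii, one in the `ξ k`, one in the signs. The first is zero for
`n ≥ N` of parity `ε`, the second for `n < N`, the third for the other parity. -/
theorem IsIsotropicExpansion.exists_form_pos (hd : 3 ≤ d) (hα : IsIsotropicExpansion d K α)
    (hK : IsStrictPosDefKernelOn {0}ᶜ K) {m : ℕ} {r : Fin m → ℝ≥0} {c : Fin m → ℂ}
    (hr : Function.Injective r) (hr0 : ∀ i, 0 < r i) (hc : c ≠ 0) {ε : ℝ} (hε : ε = 1 ∨ ε = -1)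
    (N : ℕ) : ∃ n ≥ N, (-1) ^ n = ε ∧ 0 < kernelForm (α n) r c := by
  by_contra! hcon
  choose P hP using exists_polynomial_normGegenbauer d
  obtain ⟨p, x, y, b, hb, hx, hx0, hxy, hann⟩ :=
    exists_weights_annihilating_monomials ((Finset.range N).sup fun n => (P n).natDegree)
  obtain ⟨e, f, he, hf, hef⟩ := exists_orthonormal_pair hd
  set ξ : Fin p → RSpace d := fun k => x k • e + y k • f with hξ
  have hee : inner ℝ e e = (1 : ℝ) := by rw [real_inner_self_eq_norm_sq, he, one_pow]
  have hff : inner ℝ f f = (1 : ℝ) := by rw [real_inner_self_eq_norm_sq, hf, one_pow]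
  have hfe : inner ℝ f e = (0 : ℝ) := by rw [real_inner_comm, hef]
  have hinner : ∀ k l, inner ℝ (ξ k) (ξ l) = x k * x l + y k * y l := fun k l => by
    simp only [hξ, inner_add_left, inner_add_right, real_inner_smul_left, real_inner_smul_right,
      hee, hff, hef, hfe]
    ring
  have hinnere : ∀ k, inner ℝ (ξ k) e = x k := fun k => by
    simp only [hξ, inner_add_left, real_inner_smul_left, hee, hfe]
    ring
  have hξ1 : ∀ k, ‖ξ k‖ = 1 := fun k => by
    rw [← sq_eq_sq₀ (norm_nonneg _) zero_le_one, ← real_inner_self_eq_norm_sq, hinner, one_pow,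
      ← hxy k]
    ring
  let s : Bool → ℝ := fun β => if β then 1 else -1
  -- The sign form is the square of `1 + ε * (-1) ^ n`, which vanishes unless `(-1) ^ n = ε`.
  let τ : Bool → ℝ := fun β => if β then 1 else ε
  have hs : ∀ β, |s β| = 1 := fun β => by cases β <;> simp [s]
  let z : Fin m × (Fin p × Bool) → RSpace d := fun q => (r q.1 : ℝ) • s q.2.2 • ξ q.2.1
  let C : Fin m × (Fin p × Bool) → ℂ := fun q => c q.1 * ((b q.2.1 : ℂ) * (τ q.2.2 : ℂ))
  have hznorm : ∀ q, ‖z q‖ = r q.1 := fun q => by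
    simp [z, norm_smul, hs, hξ1]
  have hz0 : ∀ q, z q ∈ ({0}ᶜ : Set (RSpace d)) := fun q => by
    rw [Set.mem_compl_singleton_iff, ← norm_ne_zero_iff, hznorm]
    exact_mod_cast (hr0 q.1).ne'
  have hzdir : ∀ q, (‖z q‖⁻¹ : ℝ) • z q = s q.2.2 • ξ q.2.1 := fun q => by
    rw [hznorm]
    exact inv_smul_smul₀ (by exact_mod_cast (hr0 q.1).ne') _
  have hzinj : Function.Injective z := by
    rintro ⟨i, k, β⟩ ⟨j, l, β'⟩ h
    have h1 : i = j := hr (NNReal.coe_injective (by rw [← hznorm (i, k, β), h, hznorm]))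
    have h2 : s β • ξ k = s β' • ξ l := by
      rw [← hzdir (i, k, β), h, hzdir]
    -- Since `x k > 0`, the sign of the inner product with `e` separates the half circle from its
    -- antipode.
    have h3 : s β * x k = s β' * x l := by
      have := congrArg (fun v => inner ℝ v e) h2
      simpa only [real_inner_smul_left, hinnere] using this
    have hk := hx0 k
    have hl := hx0 l
    cases β <;> cases β' <;> simp only [s, if_true, Bool.false_eq_true, if_false] at h3
    · rw [h1, hx (show x k = x l by linarith)]
    · linarith
    · linarith
    · rw [h1, hx (show x k = x l by linarith)]
  have hC : C ≠ 0 := by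
    obtain ⟨i, hi⟩ := Function.ne_iff.1 hc
    obtain ⟨k, hk⟩ := Function.ne_iff.1 hb
    refine Function.ne_iff.2 ⟨(i, k, true), ?_⟩
    simpa [C, τ] using ⟨hi, hk⟩
  have hsum := hasSum_hermForm (fun q q' => hα.hasSum (z q) (z q')) C
  have hterm : ∀ n, hermForm (fun q q' => α n ‖z q‖₊ ‖z q'‖₊ * (normGegenbauer d n
      (inner ℝ ((‖z q‖⁻¹ : ℝ) • z q) ((‖z q'‖⁻¹ : ℝ) • z q')) : ℂ)) C = 0 := fun n => by
    have hfac : ∀ q q', α n ‖z q‖₊ ‖z q'‖₊ * (normGegenbauer d n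
        (inner ℝ ((‖z q‖⁻¹ : ℝ) • z q) ((‖z q'‖⁻¹ : ℝ) • z q')) : ℂ) =
        α n (r q.1) (r q'.1) * ((normGegenbauer d n (inner ℝ (ξ q.2.1) (ξ q'.2.1)) : ℂ) *
          ((s q.2.2 : ℂ) ^ n * (s q'.2.2 : ℂ) ^ n)) := fun q q' => by
      have hn : ∀ q, ‖z q‖₊ = r q.1 := fun q => NNReal.eq (hznorm q)
      rw [hn, hn, hzdir, hzdir, real_inner_smul_left, real_inner_smul_right]
      congr 1
      obtain ⟨i, k, β⟩ := q
      obtain ⟨j, l, β'⟩ := q'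
      cases β <;> cases β' <;> simp [s, normGegenbauer_neg, ← mul_pow, mul_comm]
    simp only [hfac]
    rw [hermForm_prod (fun i j => α n (r i) (r j))
        (fun k l : Fin p × Bool => (normGegenbauer d n (inner ℝ (ξ k.1) (ξ l.1)) : ℂ) *
          ((s k.2 : ℂ) ^ n * (s l.2 : ℂ) ^ n)) c (fun k => (b k.1 : ℂ) * (τ k.2 : ℂ)),
      hermForm_prod (fun k l => (normGegenbauer d n (inner ℝ (ξ k) (ξ l)) : ℂ))
        (fun β β' => (s β : ℂ) ^ n * (s β' : ℂ) ^ n) (fun k => (b k : ℂ)) fun β => (τ β : ℂ)]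
    by_cases hn : (-1 : ℝ) ^ n = ε
    · rcases lt_or_ge n N with hnN | hnN
      · have hG : hermForm (fun k l => (normGegenbauer d n (inner ℝ (ξ k) (ξ l)) : ℂ))
            (fun k => (b k : ℂ)) = 0 := by
          unfold hermForm
          rw [Finset.sum_comm]
          refine Finset.sum_eq_zero fun l _ => ?_
          have h := sum_eval_eq_zero_of_annihilating hann
            (Finset.le_sup (f := fun n => (P n).natDegree) (Finset.mem_range.2 hnN)) (x l) (y l)
          calc _ = ((b l * ∑ k, b k * (P n).eval (x k * x l + y k * y l) : ℝ) : ℂ) := by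
                rw [Finset.mul_sum]
                push_cast
                refine Finset.sum_congr rfl fun k _ => ?_
                rw [Complex.conj_ofReal, hP, hinner]
                ring
            _ = 0 := by rw [h]; simp
        rw [hG, zero_mul, mul_zero]
      · have h0 : hermForm (fun i j => α n (r i) (r j)) c = 0 := by
          by_contra hne
          exact hcon n hnN hn (((hα.posDef n).hermForm_nonneg r c).lt_of_ne' hne)
        rw [h0, zero_mul]
    · have h0 : hermForm (fun β β' => (s β : ℂ) ^ n * (s β' : ℂ) ^ n) (fun β => (τ β : ℂ)) = 0 := by
        have hn' : ε = -(-1 : ℝ) ^ n := by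
          rcases neg_one_pow_eq_or ℝ n with h | h <;> rcases hε with h' | h' <;> simp_all
        simp only [hermForm, Fintype.sum_bool, s, τ, hn']
        rcases neg_one_pow_eq_or ℂ n with h | h <;> simp [h]
      rw [h0, mul_zero, mul_zero]
  simp only [hterm] at hsum
  have hpos := hK.hermForm_pos hzinj hz0 hC
  rw [hsum.unique hasSum_zero] at hpos
  exact lt_irrefl _ hpos

theorem IsIsotropicExpansion.formsPosInfEvenOdd (hd : 3 ≤ d) (hα : IsIsotropicExpansion d K α)
    (hK : IsStrictPosDefKernelOn {0}ᶜ K) : FormsPosInfEvenOdd α := by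
  intro m r c hr hr0 hc
  constructor <;> refine Set.infinite_of_forall_exists_gt fun N => ?_
  · obtain ⟨n, hn, hpar, hpos⟩ := hα.exists_form_pos hd hK hr hr0 hc (.inl rfl) (N + 1)
    exact ⟨n, ⟨(neg_one_pow_eq_one_iff_even (by norm_num)).1 hpar, hpos⟩, hn⟩
  · obtain ⟨n, hn, hpar, hpos⟩ := hα.exists_form_pos hd hK hr hr0 hc (.inr rfl) (N + 1)
    exact ⟨n, ⟨(neg_one_pow_eq_neg_one_iff_odd (by norm_num)).1 hpar, hpos⟩, hn⟩

end Necessity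

/-! ### Tail sums of the coefficient kernels -/

section Tails

theorem IsPosDefKernel.apply_self_nonneg {X : Type*} {K : X → X → ℂ} (hK : IsPosDefKernel K)
    (x : X) : 0 ≤ K x x := by
  simpa [kernelForm] using hK 1 (fun _ => x) (fun _ => 1)

/-- Testing with coefficients `(1, ±1)` and `(1, ±I)` bounds the real and the imaginary part. This
passes summability from the diagonal to all arguments. -/
theorem IsPosDefKernel.norm_apply_le {X : Type*} {K : X → X → ℂ} (hK : IsPosDefKernel K)
    (x y : X) : ‖K x y‖ ≤ (K x x).re + (K y y).re := by
  have hform : ∀ a b : ℂ, 0 ≤ a * conj a * K x x + a * conj b * K x y +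
      (b * conj a * K y x + b * conj b * K y y) := fun a b => by
    simpa [kernelForm, Fin.sum_univ_two] using hK 2 ![x, y] ![a, b]
  have hx := Complex.nonneg_iff.1 (hK.apply_self_nonneg x)
  have hy := Complex.nonneg_iff.1 (hK.apply_self_nonneg y)
  have h1 := Complex.nonneg_iff.1 (hform 1 1)
  have h2 := Complex.nonneg_iff.1 (hform 1 (-1))
  have h3 := Complex.nonneg_iff.1 (hform 1 Complex.I)
  have h4 := Complex.nonneg_iff.1 (hform 1 (-Complex.I))
  simp at h1 h2 h3 h4
  have hre : |(K x y).re| * 2 ≤ (K x x).re + (K y y).re := by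
    rw [← abs_two, ← abs_mul, abs_le]
    constructor <;> linarith
  have him : |(K x y).im| * 2 ≤ (K x x).re + (K y y).re := by
    rw [← abs_two, ← abs_mul, abs_le]
    constructor <;> linarith
  linarith [Complex.norm_le_abs_re_add_abs_im (K x y)]

variable {α : ℕ → ℝ≥0 → ℝ≥0 → ℂ}

theorem summable_apply_of_summable_diag (hpos : ∀ n, IsPosDefKernel (α n))
    (hsum : ∀ r, Summable fun n => α n r r) (r s : ℝ≥0) : Summable fun n => α n r s :=
  Summable.of_norm_bounded
    (((Complex.hasSum_re (hsum r).hasSum).summable).add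
      ((Complex.hasSum_re (hsum s).hasSum).summable))
    fun n => (hpos n).norm_apply_le r s

theorem kernelForm_tsum_pos_iff (hpos : ∀ n, IsPosDefKernel (α n))
    (hsum : ∀ r, Summable fun n => α n r r) {I : Type*} {f : I → ℕ} (hf : Function.Injective f)
    {m : ℕ} (r : Fin m → ℝ≥0) (c : Fin m → ℂ) :
    0 < kernelForm (fun r s => ∑' n, α (f n) r s) r c ↔ ∃ n, 0 < kernelForm (α (f n)) r c := by
  have h : HasSum (fun n => kernelForm (α (f n)) r c)
      (kernelForm (fun r s => ∑' n, α (f n) r s) r c) :=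
    hasSum_sum fun i _ => hasSum_sum fun j _ =>
      (((summable_apply_of_summable_diag hpos hsum (r i) (r j)).comp_injective
        hf).hasSum.mul_left _)
  constructor
  · intro hp
    by_contra! hcon
    have h0 : ∀ n, kernelForm (α (f n)) r c = 0 := fun n => by
      by_contra hne
      exact hcon n ((hpos _ m r c).lt_of_ne' hne)
    simp only [h0] at h
    rw [h.unique hasSum_zero] at hp
    exact lt_irrefl _ hp
  · rintro ⟨n, hn⟩
    exact hn.trans_le (le_hasSum h n fun k _ => hpos _ m r c)

theorem tailsStrictPosDef_iff (hpos : ∀ n, IsPosDefKernel (α n))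
    (hsum : ∀ r, Summable fun n => α n r r) : TailsStrictPosDef α ↔ FormsPosInfEvenOdd α := by
  have heven : ∀ γ : ℝ, Function.Injective fun n : {n : ℕ // γ ≤ 2 * (n : ℝ)} => 2 * (n : ℕ) :=
    fun γ a b hab => Subtype.ext (by simpa using hab)
  have hodd : ∀ γ : ℝ,
      Function.Injective fun n : {n : ℕ // γ ≤ 2 * (n : ℝ) + 1} => 2 * (n : ℕ) + 1 :=
    fun γ a b hab => Subtype.ext (by simpa using hab)
  constructor
  · intro h m r c hr hr0 hc
    constructor <;> refine Set.infinite_of_forall_exists_gt fun N => ?_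
    · obtain ⟨⟨n, hn⟩, hp⟩ := (kernelForm_tsum_pos_iff hpos hsum (heven _) r c).1
        ((h (N + 1) (by positivity)).1 m r c hr hr0 hc)
      exact ⟨2 * n, ⟨even_two_mul n, hp⟩, by
        have : N + 1 ≤ 2 * n := by exact_mod_cast hn
        omega⟩
    · obtain ⟨⟨n, hn⟩, hp⟩ := (kernelForm_tsum_pos_iff hpos hsum (hodd _) r c).1
        ((h (N + 1) (by positivity)).2 m r c hr hr0 hc)
      exact ⟨2 * n + 1, ⟨odd_two_mul_add_one n, hp⟩, by
        have : N + 1 ≤ 2 * n + 1 := by exact_mod_cast hn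
        omega⟩
  · intro h γ _
    constructor <;> intro m r c hr hr0 hc
    · obtain ⟨n, ⟨⟨k, rfl⟩, hp⟩, hn⟩ := (h m r c hr hr0 hc).1.exists_gt ⌈γ⌉₊
      rw [← two_mul] at hp
      refine (kernelForm_tsum_pos_iff hpos hsum (heven γ) r c).2 ⟨⟨k, ?_⟩, hp⟩
      have : γ ≤ (k + k : ℕ) := (Nat.le_ceil γ).trans (by exact_mod_cast hn.le)
      push_cast at this
      linarith
    · obtain ⟨n, ⟨⟨k, rfl⟩, hp⟩, hn⟩ := (h m r c hr hr0 hc).2.exists_gt ⌈γ⌉₊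
      refine (kernelForm_tsum_pos_iff hpos hsum (hodd γ) r c).2 ⟨⟨k, ?_⟩, hp⟩
      have : γ ≤ (2 * k + 1 : ℕ) := (Nat.le_ceil γ).trans (by exact_mod_cast hn.le)
      push_cast at this
      linarith

theorem InfEvenOddStrictPosDef.formsPosInfEvenOdd (h : InfEvenOddStrictPosDef α) :
    FormsPosInfEvenOdd α := fun m r c hr hr0 hc =>
  ⟨h.1.mono fun _ hn => ⟨hn.1, hn.2 m r c hr hr0 hc⟩,
    h.2.mono fun _ hn => ⟨hn.1, hn.2 m r c hr hr0 hc⟩⟩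

end Tails

/-! ### The role of the origin and the final equivalences -/

section Characterization

variable {d : ℕ∞} {K : RSpace d → RSpace d → ℂ} {α : ℕ → ℝ≥0 → ℝ≥0 → ℂ}

theorem IsIsotropicExpansion.apply_zero (hα : IsIsotropicExpansion d K α) : K 0 0 = α 0 0 0 := by
  have h := hα.hasSum 0 0
  have h' := hasSum_single (f := fun n => α n ‖(0 : RSpace d)‖₊ ‖(0 : RSpace d)‖₊ *
    (normGegenbauer d n (inner ℝ ((‖(0 : RSpace d)‖⁻¹ : ℝ) • (0 : RSpace d))
      ((‖(0 : RSpace d)‖⁻¹ : ℝ) • (0 : RSpace d))) : ℂ)) 0 fun n hn => by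
    simp [hα.zero_left n (Nat.one_le_iff_ne_zero.2 hn)]
  rw [h.unique h']
  simp [normGegenbauer_zero]

theorem IsIsotropicExpansion.strictPosDefOn_compl_zero (hd : 3 ≤ d)
    (hα : IsIsotropicExpansion d K α) (hF : FormsPosInfEvenOdd α) :
    IsStrictPosDefKernelOn {0}ᶜ K := by
  intro m x c hx hx0 hc
  obtain ⟨i, hi⟩ := Function.ne_iff.1 hc
  exact hα.hermForm_pos hd hF hx hi (hx0 i)

theorem IsIsotropicExpansion.strictPosDefOn_univ (hd : 3 ≤ d)
    (hα : IsIsotropicExpansion d K α) (h0 : 0 < α 0 0 0) (hF : FormsPosInfEvenOdd α) :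
    IsStrictPosDefKernelOn Set.univ K := by
  intro m x c hx _ hc
  by_cases h : ∃ i, c i ≠ 0 ∧ x i ≠ 0
  · obtain ⟨i, hi, hxi⟩ := h
    exact hα.hermForm_pos hd hF hx hi hxi
  -- What remains is a coefficient vector supported at the origin alone, whose form is `|c i| ^ 2 *
  -- α 0 0 0`.
  push Not at h
  obtain ⟨i, hi⟩ := Function.ne_iff.1 hc
  have hi' : c i ≠ 0 := hi
  have hcj : ∀ j, j ≠ i → c j = 0 := fun j hj => by
    by_contra hne
    exact hj (hx ((h j hne).trans (h i hi').symm))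
  have hform : kernelForm K x c = c i * conj (c i) * α 0 0 0 := by
    unfold kernelForm
    rw [Finset.sum_eq_single i (fun j _ hj => by simp [hcj j hj]) (by simp),
      Finset.sum_eq_single i (fun j _ hj => by simp [hcj j hj]) (by simp), h i hi', hα.apply_zero]
  rw [hform, Complex.mul_conj]
  exact mul_pos (by exact_mod_cast Complex.normSq_pos.2 hi') h0

theorem IsIsotropicExpansion.apply_zero_pos (hα : IsIsotropicExpansion d K α)
    (hK : IsStrictPosDefKernelOn Set.univ K) : 0 < α 0 0 0 := by
  have h := hK 1 (fun _ => 0) (fun _ => 1) (Function.injective_of_subsingleton _)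
    (fun _ => Set.mem_univ _) (Function.ne_iff.2 ⟨0, by simp⟩)
  simpa [kernelForm, hα.apply_zero] using h

end Characterization

theorem theorem2 (d : ℕ∞) (hd : 3 ≤ d) (K : RSpace d → RSpace d → ℂ)
    (hcont : Continuous (Function.uncurry K)) (hpos : IsPosDefKernel K) (hiso : IsIsotropic K)
    (α : ℕ → ℝ≥0 → ℝ≥0 → ℂ) (hα : IsIsotropicExpansion d K α) :
    List.TFAE [
      IsStrictPosDefKernelOn Set.univ K,
      0 < α 0 0 0 ∧ FormsPosInfEvenOdd α,
      0 < α 0 0 0 ∧ TailsStrictPosDef α] ∧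
    (0 < α 0 0 0 ∧ InfEvenOddStrictPosDef α → IsStrictPosDefKernelOn Set.univ K) ∧
    List.TFAE [
      IsStrictPosDefKernelOn {0}ᶜ K,
      FormsPosInfEvenOdd α,
      TailsStrictPosDef α] ∧
    (InfEvenOddStrictPosDef α → IsStrictPosDefKernelOn {0}ᶜ K) := by
  have htails := tailsStrictPosDef_iff hα.posDef hα.summable_diag
  have huniv : IsStrictPosDefKernelOn Set.univ K ↔ 0 < α 0 0 0 ∧ FormsPosInfEvenOdd α :=
    ⟨fun h => ⟨hα.apply_zero_pos h, hα.formsPosInfEvenOdd hd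
      fun m x c hx _ hc => h m x c hx (fun _ => Set.mem_univ _) hc⟩,
      fun h => hα.strictPosDefOn_univ hd h.1 h.2⟩
  have hcompl : IsStrictPosDefKernelOn {0}ᶜ K ↔ FormsPosInfEvenOdd α :=
    ⟨hα.formsPosInfEvenOdd hd, hα.strictPosDefOn_compl_zero hd⟩
  refine ⟨?_, fun h => huniv.2 ⟨h.1, h.2.formsPosInfEvenOdd⟩, ?_,
    fun h => hcompl.2 h.formsPosInfEvenOdd⟩
  · rw [htails]
    tfae_have 1 ↔ 2 := huniv
    tfae_have 2 ↔ 3 := Iff.rfl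
    tfae_finish
  · tfae_have 1 ↔ 2 := hcompl
    tfae_have 3 ↔ 2 := htails
    tfae_finish
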